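/- Let $P$ be a poset, $R$ a commutative ring with unit, and $\overline p\colon P\to\mathbb Z\cup\{\pm\infty\}$ a perversity, i.e. a map with value $0$ on the maximal elements of $P$. *Notation.* Let $\Delta[P]$ be the category of simplices of the nerve of $P$: an object is a chain $\sigma=(t_0\le\dots\le t_m)$ in $P$, a morphism is a monotone map of the index sets compatible with the chains. Write $\dim\sigma=m$. The chain $\sigma$ is *regular* if $t_m$ is maximal in $P$, and $\Delta[P]^+\subset\Delta[P]$ is the full subcategory of regular simplices. Let $\mathrm{Sset}_P$ and $\mathrm{Sset}_P^+$ be the categories of presheaves of sets on $\Delta[P]$ and $\Delta[P]^+$. Both are simplicial categories, with $(K\otimes X)(\sigma)=K(\sigma)\times X_{\dim\sigma}$ for a simplicial set $X$ and $\mathrm{Hom}^\Delta(K,B)_n=\mathrm{Hom}(K\otimes\Delta[n],B)$. Put $[K,B]=\pi_0\mathrm{Hom}^\Delta(K,B)$; an object $B$ is *s-fibrant* if $\mathrm{Hom}^\Delta(Z,B)$ is a Kan complex for every $Z$. Let $\sigma=\Delta[q_0]*\dots*\Delta[q_\ell]$ be a regular simplex, where $\Delta[q_i]$ is spanned by the vertices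 sent to $s_i$ and $s_0<\dots<s_\ell$. Let $N^*$ denote normalized cochains with coefficients in $R$, let $cF$ be the cone on $F$ with apex as last vertex, and let $c\emptyset$ be the apex. Set $$\widetilde N^*(\Delta[\sigma])=N^*(c\Delta[q_0])\otimes\dots\otimes N^*(c\Delta[q_{\ell-1}])\otimes N^*(\Delta[q_\ell]).$$ It has the basis $\mathbf 1_{(F,\varepsilon)}$ dual to the products $(F,\varepsilon)=(F_0,\varepsilon_0)\times\dots\times(F_\ell,\varepsilon_\ell)$ with $\varepsilon_\ell=0$, where $(F_i,0)=F_i\ne\emptyset$ and $(F_i,1)=cF_i$. The perverse degree $\|(F,\varepsilon)\|_s$ along $s\in P$ is $\sum_{j>i}\dim(F_j,\varepsilon_j)$ if $s=s_i$ and $\varepsilon_i=0$, and it is $-\infty$ otherwise; for a cochain $\omega$, $\|\omega\|_s$ is the maximum over the basis elements occurring in $\omega$ (and $\|0\|_s=-\infty$). Let $\widetilde N^*_{\overline p}(\Delta[\sigma];R)$ be the subcomplex of those $\omega$ such that $\|\omega\|_s\le\overline p(s)$ and $\|\delta\omega\|_s\le\overline p(s)$ for all $s\in P$, and put $\widetilde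 N^*_{\overline p}(\Delta[\sigma];R)=0$ if $\sigma$ is not regular. This is a contravariant functor of $\sigma\in\Delta[P]$ with values in the category $\mathbf{M_{dg}}$ of cochain complexes of $R$-modules concentrated in degrees $\ge0$. For $L\in\mathrm{Sset}_P$ and $M\in\mathbf{M_{dg}}$ put $$\widetilde N^k_{\overline p}(L;R)=\mathrm{Hom}_{\mathrm{Sset}_P}\bigl(L,\widetilde N^k_{\overline p}(\Delta[\bullet];R)\bigr),\quad \mathscr H^n_{\overline p}(L;R)=H^n\bigl(\widetilde N^*_{\overline p}(L;R)\bigr),\quad \langle M\rangle_{\overline p}(\sigma)=\mathrm{Hom}_{\mathbf{M_{dg}}}\bigl(M,\widetilde N^*_{\overline p}(\Delta[\sigma];R)\bigr),$$ and let $\mathcal T\colon\mathrm{Hom}(L,\langle M\rangle_{\overline p})\cong\mathrm{Hom}_{\mathbf{M_{dg}}}(M,\widetilde N^*_{\overline p}(L;R))$, $\mathcal T(\Phi)(w)(x)=\Phi(x)(w)$, be the adjunction bijection. The same definitions over $\Delta[P]^+$ give $\langle M\rangle^+_{\overline p}$, $\mathscr H^n_{\overline p}(K;R)$ for $K\in\mathrm{Sset}_P^+$,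 and $\mathcal T$. Let $R(n)$ be the complex $R$ concentrated in degree $n$, and set $K(R,n,P,\overline p)=\langle R(n)\rangle_{\overline p}$ and $K(R,n,P,\overline p)^+=\langle R(n)\rangle_{\overline p}^+$. For $M,N\in\mathbf{M_{dg}}$ let $[M,N]$ be the set of cochain maps $M\to N$ modulo cochain homotopy. **Theorem.** 1. For every $M\in\mathbf{M_{dg}}$, the object $\langle M\rangle_{\overline p}$ of $\mathrm{Sset}_P$ is s-fibrant. 2. For every s-fibrant $L\in\mathrm{Sset}_P$ and every $M\in\mathbf{M_{dg}}$, the adjunction induces a bijection $[L,\langle M\rangle_{\overline p}]\cong[M,\widetilde N^*_{\overline p}(L;R)]$, $[\Phi]\mapsto[\mathcal T(\Phi)]$. 3. For every $n\ge0$ and every s-fibrant $L\in\mathrm{Sset}_P$, the rule $[\Phi]\mapsto[\mathcal T(\Phi)(1)]$ is a bijection $[L,K(R,n,P,\overline p)]\cong\mathscr H^n_{\overline p}(L;R)$, natural in $L$; that is, blown up cohomology is representable. 4. Similarly, for every $n\ge0$, $K(R,n,P,\overline p)^+$ is s-fibrant in $\mathrm{Sset}_P^+$, and for every s-fibrant $K\in\mathrm{Sset}_P^+$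 the rule $[\Phi]\mapsto[\mathcal T(\Phi)(1)]$ is a bijection $[K,K(R,n,P,\overline p)^+]\cong\mathscr H^n_{\overline p}(K;R)$, natural in $K$. -/

import Mathlib

open CategoryTheory Opposite Simplicial

universe u v

namespace BlownUp

/-- An object of the category `Δ[P]` of simplices of the nerve of the poset `P`: a simplex
`s₀ ≤ s₁ ≤ ⋯ ≤ sₘ` of the nerve, that is, a monotone map `[m] → P`. -/
structure Simp (P : Type u) [PartialOrder P] where
  /-- the shape `[m]` -/
  dom : SimplexCategory
  /-- the chain `s₀ ≤ ⋯ ≤ sₘ` -/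
  chain : Fin (dom.len + 1) →o P

variable {P : Type u} [PartialOrder P]

/-- A morphism of `Δ[P]`: a commutative triangle over the nerve, that is, a monotone map of the
shapes that is compatible with the two chains. -/
@[ext]
structure Simp.Hom (σ τ : Simp P) where
  /-- the underlying morphism `[m] → [n]` -/
  map : σ.dom ⟶ τ.dom
  w : ∀ i, τ.chain (map i) = σ.chain i

instance : Category.{0} (Simp P) where
  Hom := Simp.Hom
  id σ := ⟨𝟙 _, fun _ => rfl⟩
  comp f g := ⟨f.map ≫ g.map, fun i => (g.w (f.map i)).trans (f.w i)⟩

variable (P) in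
/-- The functor `Δ[P] ⥤ Δ` that forgets the chain. -/
def Simp.shape : Simp P ⥤ SimplexCategory where
  obj σ := σ.dom
  map f := f.map

/-- The last (largest) element `sₘ` of the chain. -/
def Simp.top (σ : Simp P) : P := σ.chain (Fin.last _)

/-- A simplex of the nerve is regular if its last element is maximal in `P`. -/
def Simp.IsRegular (σ : Simp P) : Prop := IsMax σ.top

variable (P) in
/-- The full subcategory `Δ[P]⁺` of `Δ[P]` on the regular simplices. -/
abbrev RegSimp := ObjectProperty.FullSubcategory (fun σ : Simp P => σ.IsRegular)

variable (P) in
/-- The inclusion `Δ[P]⁺ ⥤ Δ[P]`. -/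
abbrev RegSimp.incl : RegSimp P ⥤ Simp P := ObjectProperty.ι _

/-! ### The blow-up of a simplex and its cochains -/

/-- Candidates for the faces `(F, ε)` of the blow-up
`cΔ[q₀] × ⋯ × cΔ[q_{ℓ-1}] × Δ[q_ℓ]` of a simplex `Δ[m] = Δ[q₀] * ⋯ * Δ[q_ℓ]` of the nerve: the
first component is the set `F = F₀ ⊔ ⋯ ⊔ F_ℓ` of vertices of `Δ[m]`, the second one is the set
`Z` of the strata `sᵢ` with `εᵢ = 0`. Thus the `i`-th factor of the face is the face `Fᵢ` of
`Δ[qᵢ]` if `sᵢ ∈ Z`, and the cone `cFᵢ` with apex `vᵢ` (where `c∅ = [vᵢ]`) if `sᵢ ∉ Z`. -/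
abbrev Cell (σ : Simp P) := Finset (Fin (σ.dom.len + 1)) × Finset P

/-- `(F, Z)` is a face of the blow-up of `σ`: the simplex `σ` is regular, the last factor is not
coned (`ε_ℓ = 0`), and a factor `Fᵢ` with `εᵢ = 0` is not empty. -/
def IsFace (σ : Simp P) (c : Cell σ) : Prop :=
  σ.IsRegular ∧ σ.top ∈ c.2 ∧ ∀ s ∈ c.2, ∃ i ∈ c.1, σ.chain i = s

open scoped Classical in
/-- For `s = sᵢ`, the dimension `‖(F, ε)‖ᵢ` of the product of the factors of index `> i` of the
face. The factor at `t` has dimension `|F_t| - 1` if `ε = 0` and `|F_t|` if `ε = 1`. -/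
noncomputable def dimAbove (σ : Simp P) (c : Cell σ) (s : P) : ℤ :=
  ((c.1.filter (fun i => s < σ.chain i)).card : ℤ) - ((c.2.filter (fun t => s < t)).card : ℤ)

open scoped Classical in
/-- The perverse degree `‖(F, ε)‖ₛ` along `s`, with values in `ℤ ∪ {-∞, ∞}`. It is `-∞` if `s` is
not a stratum of the simplex or if its factor is coned. -/
noncomputable def perverseDegree (σ : Simp P) (c : Cell σ) (s : P) : WithBot (WithTop ℤ) :=
  if s ∈ c.2 then ((dimAbove σ c s : WithTop ℤ) : WithBot (WithTop ℤ)) else ⊥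

open scoped Classical in
/-- For a face and a vertex `i ∈ F_s`, a number which, modulo 2, is the sum of the dimensions of the
factors before the one of `s` plus the number of the vertices of the factor at `s` that precede `i`.
(That number is `|{j ∈ F : j < i}| - |{t ∈ Z : t < s}|`.) It gives the Koszul sign of the deletion
of `i`. -/
noncomputable def vertexPos (σ : Simp P) (c : Cell σ) (i : Fin (σ.dom.len + 1)) : ℕ :=
  (c.1.filter (fun j => j < i)).card + (c.2.filter (fun t => t < σ.chain i)).card

open scoped Classical in
/-- The same number for the apex `v_s`, the last vertex of its factor, if the factor at `s` is
coned. -/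
noncomputable def apexPos (σ : Simp P) (c : Cell σ) (s : P) : ℕ :=
  (c.1.filter (fun j => σ.chain j ≤ s)).card + (c.2.filter (fun t => t < s)).card

variable (R : Type u) [CommRing R]

open scoped Classical in
/-- The differential of `N*(cΔ[q₀]) ⊗ ⋯ ⊗ N*(cΔ[q_{ℓ-1}]) ⊗ N*(Δ[q_ℓ])` in the dual basis
`1_{(F, ε)}`, a cochain being identified with the function of its coefficients. The value of `δ ω`
on a face is the alternating sum of the values of `ω` on its codimension one faces: those
obtained by deleting a vertex `i ∈ F`, and those obtained by deleting the apex of a coned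
factor `cF_s` with `F_s ≠ ∅`. -/
noncomputable def delta (σ : Simp P) : (Cell σ → R) →ₗ[R] (Cell σ → R) where
  toFun ω c :=
    if IsFace σ c then
      (∑ i ∈ c.1, (-1) ^ vertexPos σ c i * ω (c.1.erase i, c.2)) +
        ∑ s ∈ c.1.image σ.chain \ c.2, (-1) ^ apexPos σ c s * ω (c.1, insert s c.2)
    else 0
  map_add' ω η := by
    ext c
    by_cases h : IsFace σ c
    · simp only [h, if_true, Pi.add_apply, mul_add, Finset.sum_add_distrib]; ring
    · simp [h]
  map_smul' a ω := by
    ext c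
    by_cases h : IsFace σ c
    · simp only [h, if_true, Pi.smul_apply, smul_eq_mul, mul_add, Finset.mul_sum, RingHom.id_apply]
      congr 1 <;> exact Finset.sum_congr rfl fun _ _ => by ring
    · simp [h]

variable {R}

/-- `ω` is an element of degree `k` of the blown up complex `Ñ*(Δ[σ])`: it is supported on the
faces of dimension `k`, i.e. `|F| - |Z| = k`. -/
def IsCochain (σ : Simp P) (k : ℕ) (ω : Cell σ → R) : Prop :=
  ∀ c, ω c ≠ 0 → IsFace σ c ∧ c.1.card = c.2.card + k

theorem sum_sum_erase_eq_zero {α : Type*} [DecidableEq α] (S : Finset α) (f : α → α → R)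
    (h : ∀ x ∈ S, ∀ y ∈ S, x ≠ y → f x y + f y x = 0) :
    ∑ x ∈ S, ∑ y ∈ S.erase x, f x y = 0 := by
  rw [Finset.sum_sigma']
  refine Finset.sum_involution (fun a _ => ⟨a.2, a.1⟩) ?_ ?_ ?_ ?_
  · rintro ⟨x, y⟩ ha
    simp only [Finset.mem_sigma, Finset.mem_erase] at ha
    exact h x ha.1 y ha.2.2 (Ne.symm ha.2.1)
  · rintro ⟨x, y⟩ ha _ he
    simp only [Finset.mem_sigma, Finset.mem_erase] at ha
    simp only [Sigma.mk.injEq, heq_eq_eq] at he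
    exact ha.2.1 he.1
  · rintro ⟨x, y⟩ ha
    simp only [Finset.mem_sigma, Finset.mem_erase] at ha ⊢
    exact ⟨ha.2.2, Ne.symm ha.2.1, ha.1⟩
  · rintro ⟨x, y⟩ _
    rfl

open scoped Classical in
theorem delta_apply_of_vanish (σ : Simp P) {ω : Cell σ → R}
    (hω : ∀ c, ¬ IsFace σ c → ω c = 0) (c : Cell σ) (hr : σ.IsRegular) (ht : σ.top ∈ c.2) :
    delta R σ ω c =
      (∑ i ∈ c.1, (-1) ^ vertexPos σ c i * ω (c.1.erase i, c.2)) +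
        ∑ s ∈ c.1.image σ.chain \ c.2, (-1) ^ apexPos σ c s * ω (c.1, insert s c.2) := by
  by_cases h : IsFace σ c
  · simp [delta, h]
  · have h1 : ∀ i ∈ c.1, (-1) ^ vertexPos σ c i * ω (c.1.erase i, c.2) = 0 := by
      intro i _
      rw [hω, mul_zero]
      rintro ⟨_, _, h3⟩
      refine h ⟨hr, ht, fun s hs => ?_⟩
      obtain ⟨j, hj, e⟩ := h3 s hs
      exact ⟨j, (Finset.mem_erase.1 hj).2, e⟩
    have h2 : ∀ s ∈ c.1.image σ.chain \ c.2,
        (-1) ^ apexPos σ c s * ω (c.1, insert s c.2) = 0 := by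
      intro s _
      rw [hω, mul_zero]
      rintro ⟨_, _, h3⟩
      exact h ⟨hr, ht, fun t ht => h3 t (Finset.mem_insert_of_mem ht)⟩
    rw [Finset.sum_eq_zero h1, Finset.sum_eq_zero h2]
    simp [delta, h]

theorem delta_vanish (σ : Simp P) (ω : Cell σ → R) (c : Cell σ) (h : ¬ IsFace σ c) :
    delta R σ ω c = 0 := by
  simp [delta, h]

theorem card_filter_erase {α : Type*} [DecidableEq α] (S : Finset α) (q : α → Prop)
    [DecidablePred q] (x : α) (hx : x ∈ S) :
    (S.filter q).card = ((S.erase x).filter q).card + if q x then 1 else 0 := by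
  conv_lhs => rw [← Finset.insert_erase hx]
  rw [Finset.filter_insert]
  split_ifs with h
  · rw [Finset.card_insert_of_notMem (by simp)]
  · simp

theorem card_filter_insert {α : Type*} [DecidableEq α] (S : Finset α) (q : α → Prop)
    [DecidablePred q] (x : α) (hx : x ∉ S) :
    ((insert x S).filter q).card = (S.filter q).card + if q x then 1 else 0 := by
  rw [Finset.filter_insert]
  split_ifs with h
  · rw [Finset.card_insert_of_notMem (by simp [hx])]
  · simp

theorem sign_cancel (a b : ℕ) (x : R) (h : a = b + 1 ∨ b = a + 1) :
    (-1) ^ a * x + (-1) ^ b * x = 0 := by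
  rcases h with h | h <;> subst h <;> ring

theorem delta_delta (σ : Simp P) {ω : Cell σ → R} (hω : ∀ c, ¬ IsFace σ c → ω c = 0) :
    delta R σ (delta R σ ω) = 0 := by
  classical
  ext c
  by_cases hc : IsFace σ c
  swap
  · exact delta_vanish σ _ c hc
  have hcc := hc
  obtain ⟨hr, ht, hZ⟩ := hc
  rw [delta_apply_of_vanish σ (delta_vanish σ ω) c hr ht, Pi.zero_apply]
  have e1 : ∀ i ∈ c.1, (-1) ^ vertexPos σ c i * delta R σ ω (c.1.erase i, c.2) =
      (∑ j ∈ c.1.erase i, (-1) ^ (vertexPos σ c i + vertexPos σ (c.1.erase i, c.2) j) *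
        ω ((c.1.erase i).erase j, c.2)) +
      ∑ s ∈ c.1.image σ.chain \ c.2,
        (-1) ^ (vertexPos σ c i + apexPos σ (c.1.erase i, c.2) s) *
          ω (c.1.erase i, insert s c.2) := by
    intro i hi
    rw [delta_apply_of_vanish σ hω (c.1.erase i, c.2) hr ht, mul_add, Finset.mul_sum, Finset.mul_sum]
    congr 1
    · exact Finset.sum_congr rfl fun j _ => by rw [pow_add, mul_assoc]
    · rw [← Finset.sum_subset (s₁ := (c.1.erase i).image σ.chain \ c.2)
        (s₂ := c.1.image σ.chain \ c.2)]
      · exact Finset.sum_congr rfl fun j _ => by rw [pow_add, mul_assoc]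
      · exact Finset.sdiff_subset_sdiff (Finset.image_subset_image (Finset.erase_subset _ _))
          subset_rfl
      · intro s hs hs'
        rw [hω, mul_zero]
        rintro ⟨_, _, h3⟩
        obtain ⟨j, hj, e⟩ := h3 s (Finset.mem_insert_self _ _)
        exact hs' (Finset.mem_sdiff.2 ⟨Finset.mem_image.2 ⟨j, hj, e⟩, (Finset.mem_sdiff.1 hs).2⟩)
  have e2 : ∀ s ∈ c.1.image σ.chain \ c.2,
      (-1) ^ apexPos σ c s * delta R σ ω (c.1, insert s c.2) =
      (∑ i ∈ c.1, (-1) ^ (apexPos σ c s + vertexPos σ (c.1, insert s c.2) i) *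
        ω (c.1.erase i, insert s c.2)) +
      ∑ t ∈ (c.1.image σ.chain \ c.2).erase s,
        (-1) ^ (apexPos σ c s + apexPos σ (c.1, insert s c.2) t) *
          ω (c.1, insert t (insert s c.2)) := by
    intro s hs
    rw [delta_apply_of_vanish σ hω (c.1, insert s c.2) hr (Finset.mem_insert_of_mem ht), mul_add, Finset.mul_sum,
      Finset.mul_sum]
    congr 1
    · exact Finset.sum_congr rfl fun j _ => by rw [pow_add, mul_assoc]
    · rw [← Finset.sdiff_insert]
      exact Finset.sum_congr rfl fun j _ => by rw [pow_add, mul_assoc]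
  rw [Finset.sum_congr rfl e1, Finset.sum_congr rfl e2, Finset.sum_add_distrib,
    Finset.sum_add_distrib, sum_sum_erase_eq_zero, sum_sum_erase_eq_zero, zero_add, add_zero,
    Finset.sum_comm, ← Finset.sum_add_distrib]
  · refine Finset.sum_eq_zero fun s hs => ?_
    rw [← Finset.sum_add_distrib]
    refine Finset.sum_eq_zero fun i hi => sign_cancel _ _ _ ?_
    have hsZ := (Finset.mem_sdiff.1 hs).2
    obtain ⟨j, hj, ej⟩ := Finset.mem_image.1 (Finset.mem_sdiff.1 hs).1
    have hcmp : s < σ.chain i ↔ ¬ σ.chain i ≤ s := by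
      subst ej
      constructor
      · exact fun h h' => absurd h (not_lt_of_ge h')
      · intro h
        rcases le_total i j with hij | hij
        · exact absurd (σ.chain.monotone hij) h
        · exact lt_of_le_of_ne (σ.chain.monotone hij) fun e => h e.ge
    simp only [vertexPos, apexPos]
    rw [card_filter_insert _ _ s hsZ, card_filter_erase c.1 (fun j => σ.chain j ≤ s) i hi]
    by_cases h : σ.chain i ≤ s
    · have : ¬ s < σ.chain i := fun h' => hcmp.1 h' h
      simp only [h, this, if_true, if_false]; right; omega
    · have : s < σ.chain i := hcmp.2 h
      simp only [h, this, if_true, if_false]; right; omega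
  · intro s hs t hts hst
    rw [Finset.insert_comm]
    refine sign_cancel _ _ _ ?_
    have hsZ := (Finset.mem_sdiff.1 hs).2
    have htZ := (Finset.mem_sdiff.1 hts).2
    obtain ⟨i, hi, ei⟩ := Finset.mem_image.1 (Finset.mem_sdiff.1 hs).1
    obtain ⟨j, hj, ej⟩ := Finset.mem_image.1 (Finset.mem_sdiff.1 hts).1
    have hcmp : s < t ∨ t < s := by
      rcases le_total i j with hij | hij
      · left; exact lt_of_le_of_ne (ei ▸ ej ▸ σ.chain.monotone hij) hst
      · right; exact lt_of_le_of_ne (ei ▸ ej ▸ σ.chain.monotone hij) hst.symm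
    simp only [apexPos]
    rw [card_filter_insert _ _ s hsZ, card_filter_insert _ _ t htZ]
    rcases hcmp with h | h
    · simp only [h, h.not_gt, if_true, if_false]; left; omega
    · simp only [h, h.not_gt, if_true, if_false]; right; omega
  · intro i hi j hj hij
    rw [Finset.erase_right_comm]
    refine sign_cancel _ _ _ ?_
    simp only [vertexPos]
    rw [card_filter_erase c.1 (fun k => k < i) j hj, card_filter_erase c.1 (fun k => k < j) i hi]
    rcases lt_or_gt_of_ne hij with h | h
    · simp only [h, h.not_gt, if_true, if_false]; right; omega
    · simp only [h, h.not_gt, if_true, if_false]; left; omega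

/-! ### Functoriality of the blown up cochains -/

section Functoriality

open scoped Classical in
variable (R) in
/-- The map `θ* : Ñ*(Δ[τ]) → Ñ*(Δ[σ])` induced by a morphism `θ : σ ⟶ τ`. It is the map of
normalized cochains induced by the product of the maps `cΔ[pᵢ] → cΔ[qᵢ]` (which fix the apices, and
which are `c∅ = [vᵢ] → cΔ[qᵢ]` for the strata of `τ` that `σ` does not meet): the value on a face is
zero if `θ` identifies two of its vertices, and otherwise the value on the image face. -/
noncomputable def pullback {σ τ : Simp P} (θ : σ ⟶ τ) : (Cell τ → R) →ₗ[R] (Cell σ → R) where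
  toFun ω c := if Set.InjOn θ.map c.1 then ω (c.1.image θ.map, c.2) else 0
  map_add' ω η := by
    ext c
    by_cases h : Set.InjOn θ.map c.1 <;> simp [h]
  map_smul' a ω := by
    ext c
    by_cases h : Set.InjOn θ.map c.1 <;> simp [h]

variable {σ τ : Simp P} (θ : σ ⟶ τ)

theorem chain_map (i : Fin (σ.dom.len + 1)) : τ.chain (θ.map i) = σ.chain i := θ.w i

theorem top_le {σ τ : Simp P} (θ : σ ⟶ τ) : σ.top ≤ τ.top := by
  rw [Simp.top, ← chain_map θ]
  exact τ.chain.monotone (Fin.le_last _)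

theorem isFace_iff (c : Cell σ) :
    IsFace τ (c.1.image θ.map, c.2) ↔ IsFace σ c := by
  have key : (∀ s ∈ c.2, ∃ i ∈ c.1.image θ.map, τ.chain i = s) ↔
      ∀ s ∈ c.2, ∃ i ∈ c.1, σ.chain i = s := by
    simp only [Finset.exists_mem_image, chain_map]
  constructor
  · rintro ⟨hr, ht, h⟩
    have h' := key.1 h
    obtain ⟨i, hi, e⟩ := h' _ ht
    have e' : σ.top = τ.top :=
      le_antisymm (top_le θ) (e ▸ σ.chain.monotone (Fin.le_last i))
    exact ⟨by rw [Simp.IsRegular, e']; exact hr, by rw [e']; exact ht, h'⟩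
  · rintro ⟨hr, ht, h⟩
    have e' : σ.top = τ.top := le_antisymm (top_le θ) (hr (top_le θ))
    exact ⟨by rw [Simp.IsRegular, ← e']; exact hr, by rw [← e']; exact ht, key.2 h⟩

theorem pullback_apply (ω : Cell τ → R) (c : Cell σ) (h : Set.InjOn θ.map c.1) :
    pullback R θ ω c = ω (c.1.image θ.map, c.2) := by
  simp [pullback, h]

theorem pullback_apply_zero (ω : Cell τ → R) (c : Cell σ) (h : ¬ Set.InjOn θ.map c.1) :
    pullback R θ ω c = 0 := by
  simp [pullback, h]

theorem pullback_ne_zero {ω : Cell τ → R} {c : Cell σ} (h : pullback R θ ω c ≠ 0) :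
    Set.InjOn θ.map c.1 ∧ ω (c.1.image θ.map, c.2) ≠ 0 := by
  by_cases hi : Set.InjOn θ.map c.1
  · exact ⟨hi, by rwa [pullback_apply θ ω c hi] at h⟩
  · exact absurd (pullback_apply_zero θ ω c hi) h

theorem map_mono : Monotone (θ.map : Fin (σ.dom.len + 1) → Fin (τ.dom.len + 1)) :=
  (SimplexCategory.Hom.toOrderHom θ.map).monotone

theorem card_filter_image {α β : Type*} [DecidableEq β] (S : Finset α) (f : α → β)
    (hf : Set.InjOn f S) (q : β → Prop) [DecidablePred q] (q' : α → Prop) [DecidablePred q']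
    (hq : ∀ x ∈ S, q (f x) ↔ q' x) :
    ((S.image f).filter q).card = (S.filter q').card := by
  rw [Finset.filter_image, Finset.card_image_of_injOn
    (hf.mono (Finset.coe_subset.2 (Finset.filter_subset _ S))), Finset.filter_congr hq]

theorem IsCochain.pullback {k : ℕ} {ω : Cell τ → R} (h : IsCochain τ k ω) :
    IsCochain σ k (pullback R θ ω) := by
  intro c hc
  obtain ⟨hi, hne⟩ := pullback_ne_zero θ hc
  obtain ⟨h1, h2⟩ := h _ hne
  refine ⟨(isFace_iff θ c).1 h1, ?_⟩
  rw [← h2, Finset.card_image_of_injOn hi]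

theorem perverseDegree_image (c : Cell σ) (h : Set.InjOn θ.map c.1) (s : P) :
    perverseDegree τ (c.1.image θ.map, c.2) s = perverseDegree σ c s := by
  classical
  have : dimAbove τ (c.1.image θ.map, c.2) s = dimAbove σ c s := by
    simp only [dimAbove]
    rw [card_filter_image c.1 θ.map h (fun i => s < τ.chain i) (fun i => s < σ.chain i)]
    intro i _
    rw [chain_map]
  simp only [perverseDegree, this]

theorem lt_iff_of_injOn {S : Set (Fin (σ.dom.len + 1))} (h : Set.InjOn θ.map S)
    {i j : Fin (σ.dom.len + 1)} (hi : i ∈ S) (hj : j ∈ S) : θ.map j < θ.map i ↔ j < i := by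
  constructor
  · intro hlt
    by_contra hn
    exact absurd (map_mono θ (not_lt.1 hn)) (not_le.2 hlt)
  · intro hlt
    exact lt_of_le_of_ne (map_mono θ hlt.le) fun e => hlt.ne (h hj hi e)

theorem delta_pullback {ω : Cell τ → R} (hω : ∀ c, ¬ IsFace τ c → ω c = 0) :
    delta R σ (pullback R θ ω) = pullback R θ (delta R τ ω) := by
  classical
  have hω' : ∀ c, ¬ IsFace σ c → pullback R θ ω c = 0 := by
    intro c hc
    by_contra hne
    obtain ⟨_, h2⟩ := pullback_ne_zero θ hne
    exact h2 (hω _ fun h => hc ((isFace_iff θ c).1 h))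
  ext c
  by_cases hc : IsFace σ c
  swap
  · rw [delta_vanish σ _ c hc]
    by_contra hne
    obtain ⟨_, h2⟩ := pullback_ne_zero θ (Ne.symm hne)
    exact h2 (delta_vanish τ _ _ fun h => hc ((isFace_iff θ c).1 h))
  have hcτ := (isFace_iff θ c).2 hc
  rw [delta_apply_of_vanish σ hω' c hc.1 hc.2.1]
  by_cases hi : Set.InjOn θ.map c.1
  · rw [pullback_apply θ _ c hi,
      delta_apply_of_vanish τ hω (c.1.image θ.map, c.2) hcτ.1 hcτ.2.1]
    congr 1
    · rw [Finset.sum_image hi]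
      refine Finset.sum_congr rfl fun i hic => ?_
      have hsub : ((c.1.erase i : Finset _) : Set (Fin (σ.dom.len + 1))) ⊆ c.1 := by
        exact_mod_cast Finset.erase_subset i c.1
      rw [pullback_apply θ ω (c.1.erase i, c.2) (hi.mono hsub)]
      have e : (c.1.erase i).image θ.map = (c.1.image θ.map).erase (θ.map i) := by
        ext x
        simp only [Finset.mem_image, Finset.mem_erase]
        constructor
        · rintro ⟨j, ⟨hji, hj⟩, rfl⟩
          exact ⟨fun e => hji (hi hj hic e), j, hj, rfl⟩
        · rintro ⟨hx, j, hj, rfl⟩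
          exact ⟨j, ⟨fun e => hx (by rw [e]), hj⟩, rfl⟩
      have e' : vertexPos τ (c.1.image θ.map, c.2) (θ.map i) = vertexPos σ c i := by
        simp only [vertexPos, chain_map]
        rw [card_filter_image c.1 θ.map hi (fun j => j < θ.map i) (fun j => j < i)]
        intro j hj
        exact lt_iff_of_injOn θ hi hic hj
      simp only [e, e']
    · have e : (c.1.image θ.map).image τ.chain = c.1.image σ.chain := by
        rw [Finset.image_image]
        exact Finset.image_congr fun i _ => chain_map θ i
      simp only [e]
      refine Finset.sum_congr rfl fun s _ => ?_
      rw [pullback_apply θ ω (c.1, insert s c.2) hi]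
      have e' : apexPos τ (c.1.image θ.map, c.2) s = apexPos σ c s := by
        simp only [apexPos]
        rw [card_filter_image c.1 θ.map hi (fun j => τ.chain j ≤ s) (fun j => σ.chain j ≤ s)]
        intro j _
        rw [chain_map]
      rw [e']
  · rw [pullback_apply_zero θ _ c hi]
    have h2 : ∀ s ∈ c.1.image σ.chain \ c.2,
        (-1) ^ apexPos σ c s * pullback R θ ω (c.1, insert s c.2) = 0 := fun s _ => by
      rw [pullback_apply_zero θ ω (c.1, insert s c.2) hi, mul_zero]
    rw [Finset.sum_eq_zero h2, add_zero]
    obtain ⟨a, ha, b, hb, hab, hlt⟩ : ∃ a ∈ c.1, ∃ b ∈ c.1, θ.map a = θ.map b ∧ a < b := by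
      simp only [Set.InjOn] at hi
      push Not at hi
      obtain ⟨a, ha, b, hb, e, hne⟩ := hi
      rcases lt_or_gt_of_ne hne with h | h
      · exact ⟨a, ha, b, hb, e, h⟩
      · exact ⟨b, hb, a, ha, e.symm, h⟩
    rw [← Finset.add_sum_erase _ _ ha,
      ← Finset.add_sum_erase _ _ (Finset.mem_erase.2 ⟨hlt.ne', hb⟩), ← add_assoc]
    have h3 : ∀ i ∈ (c.1.erase a).erase b,
        (-1) ^ vertexPos σ c i * pullback R θ ω (c.1.erase i, c.2) = 0 := fun i hic => by
      simp only [Finset.mem_erase] at hic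
      rw [pullback_apply_zero θ ω (c.1.erase i, c.2), mul_zero]
      intro h
      exact hlt.ne (h (by simp [ha, Ne.symm hic.2.1]) (by simp [hb, Ne.symm hic.1]) hab)
    rw [Finset.sum_eq_zero h3, add_zero]
    by_cases hmid : ∃ x ∈ c.1, a < x ∧ x < b
    · obtain ⟨x, hx, hax, hxb⟩ := hmid
      have ex : θ.map a = θ.map x :=
        le_antisymm (map_mono θ hax.le) (hab ▸ map_mono θ hxb.le)
      rw [pullback_apply_zero θ ω (c.1.erase a, c.2), pullback_apply_zero θ ω (c.1.erase b, c.2)]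
      · simp
      · intro h
        exact hax.ne (h (by simp [ha, hlt.ne]) (by simp [hx, hxb.ne]) ex)
      · intro h
        exact hxb.ne (h (by simp [hx, hax.ne']) (by simp [hb, hlt.ne']) (ex.symm.trans hab))
    · have himg : (c.1.erase a).image θ.map = (c.1.erase b).image θ.map := by
        ext x
        simp only [Finset.mem_image, Finset.mem_erase]
        constructor
        · rintro ⟨j, ⟨hja, hj⟩, rfl⟩
          by_cases hjb : j = b
          · exact ⟨a, ⟨hlt.ne, ha⟩, by rw [hjb, hab]⟩
          · exact ⟨j, ⟨hjb, hj⟩, rfl⟩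
        · rintro ⟨j, ⟨hjb, hj⟩, rfl⟩
          by_cases hja : j = a
          · exact ⟨b, ⟨hlt.ne', hb⟩, by rw [hja, hab]⟩
          · exact ⟨j, ⟨hja, hj⟩, rfl⟩
      have hinj : Set.InjOn θ.map ((c.1.erase a : Finset _) : Set (Fin (σ.dom.len + 1))) ↔
          Set.InjOn θ.map ((c.1.erase b : Finset _) : Set (Fin (σ.dom.len + 1))) := by
        rw [← Finset.card_image_iff, ← Finset.card_image_iff, himg, Finset.card_erase_of_mem ha,
          Finset.card_erase_of_mem hb]
      have heq : pullback R θ ω (c.1.erase a, c.2) = pullback R θ ω (c.1.erase b, c.2) := by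
        by_cases h : Set.InjOn θ.map ((c.1.erase a : Finset _) : Set (Fin (σ.dom.len + 1)))
        · rw [pullback_apply θ ω (c.1.erase a, c.2) h,
            pullback_apply θ ω (c.1.erase b, c.2) (hinj.1 h), himg]
        · rw [pullback_apply_zero θ ω (c.1.erase a, c.2) h,
            pullback_apply_zero θ ω (c.1.erase b, c.2) fun h' => h (hinj.2 h')]
      rw [heq]
      refine sign_cancel _ _ _ (Or.inr ?_)
      have hσ : σ.chain a = σ.chain b := by rw [← chain_map θ, hab, chain_map θ]
      have hcard : (c.1.filter (fun j => j < b)).card = (c.1.filter (fun j => j < a)).card + 1 := by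
        have : c.1.filter (fun j => j < b) = insert a (c.1.filter (fun j => j < a)) := by
          ext j
          simp only [Finset.mem_filter, Finset.mem_insert]
          constructor
          · rintro ⟨hj, hjb⟩
            rcases lt_trichotomy j a with h | h | h
            · exact Or.inr ⟨hj, h⟩
            · exact Or.inl h
            · exact absurd ⟨j, hj, h, hjb⟩ hmid
          · rintro (h | ⟨hj, h⟩)
            · subst h; exact ⟨ha, hlt⟩
            · exact ⟨hj, h.trans hlt⟩
        rw [this, Finset.card_insert_of_notMem (by simp)]
      simp only [vertexPos, hσ, hcard]
      omega

theorem pullback_id (ω : Cell σ → R) : pullback R (𝟙 σ) ω = ω := by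
  ext c
  have h : ((𝟙 σ : σ ⟶ σ).map : Fin (σ.dom.len + 1) → Fin (σ.dom.len + 1)) = id := rfl
  rw [pullback_apply (𝟙 σ) ω c (by rw [h]; exact Set.injOn_id _), h, Finset.image_id]

theorem pullback_comp {υ : Simp P} (η : τ ⟶ υ) (ω : Cell υ → R) :
    pullback R (θ ≫ η) ω = pullback R θ (pullback R η ω) := by
  ext c
  have h : ((θ ≫ η).map : Fin (σ.dom.len + 1) → Fin (υ.dom.len + 1)) = η.map ∘ θ.map := rfl
  by_cases h1 : Set.InjOn θ.map c.1
  · rw [pullback_apply θ _ c h1]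
    by_cases h2 : Set.InjOn η.map (c.1.image θ.map)
    · rw [pullback_apply η ω (c.1.image θ.map, c.2) h2, pullback_apply (θ ≫ η) ω c, h,
        Finset.image_image]
      rw [h]
      exact h2.comp h1 fun x hx => by simpa using ⟨x, hx, rfl⟩
    · rw [pullback_apply_zero η ω (c.1.image θ.map, c.2) h2, pullback_apply_zero]
      rw [h]
      intro h3
      refine h2 ?_
      rw [Finset.coe_image]
      exact h3.image_of_comp
  · rw [pullback_apply_zero θ _ c h1, pullback_apply_zero]
    rw [h]
    exact fun h3 => h1 h3.of_comp

end Functoriality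

/-! ### Perversities and intersection cochains -/

variable (P) in
/-- A perversity on the poset `P`: a map `P → ℤ ∪ {-∞, ∞}` with value `0` on the maximal
elements. -/
structure Perversity where
  /-- the underlying function -/
  toFun : P → WithBot (WithTop ℤ)
  map_isMax : ∀ s, IsMax s → toFun s = 0

/-- A cochain `ω` is `p`-allowable if `‖ω‖ₛ ≤ p(s)` for all `s`, where `‖ω‖ₛ` is the maximum of the
perverse degrees along `s` of the faces on which `ω` is not zero (and `‖0‖ₛ = -∞`). -/
def Allowable (p : Perversity P) (σ : Simp P) (ω : Cell σ → R) : Prop :=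
  ∀ s : P, ∀ c, ω c ≠ 0 → perverseDegree σ c s ≤ p.toFun s

variable (R) in
/-- The module `Ñᵏ_p(Δ[σ]; R)` of cochains `ω` of degree `k` of `p`-intersection: both `ω` and `δ ω`
are `p`-allowable. It is zero if `σ` is not regular, since there are no faces then. -/
def intersectionCochains (p : Perversity P) (σ : Simp P) (k : ℕ) : Submodule R (Cell σ → R) where
  carrier := {ω | IsCochain σ k ω ∧ Allowable p σ ω ∧ Allowable p σ (delta R σ ω)}
  zero_mem' := ⟨fun c h => absurd rfl h, fun s c h => absurd rfl h,
    fun s c h => absurd (by rw [map_zero]; rfl) h⟩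
  add_mem' := by
    rintro ω η ⟨h1, h2, h3⟩ ⟨k1, k2, k3⟩
    have key : ∀ (f g : Cell σ → R) (c), (f + g) c ≠ 0 → f c ≠ 0 ∨ g c ≠ 0 := by
      intro f g c h
      by_contra hn
      push Not at hn
      exact h (by simp [hn.1, hn.2])
    refine ⟨fun c h => (key _ _ c h).elim (h1 c) (k1 c),
      fun s c h => (key _ _ c h).elim (h2 s c) (k2 s c), fun s c h => ?_⟩
    rw [map_add] at h
    exact (key _ _ c h).elim (h3 s c) (k3 s c)
  smul_mem' := by
    rintro a ω ⟨h1, h2, h3⟩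
    have key : ∀ (f : Cell σ → R) (c), (a • f) c ≠ 0 → f c ≠ 0 :=
      fun f c h hn => h (by simp [hn])
    refine ⟨fun c h => h1 c (key _ c h), fun s c h => h2 s c (key _ c h), fun s c h => ?_⟩
    rw [map_smul] at h
    exact h3 s c (key _ c h)

theorem IsCochain.vanish {σ : Simp P} {k : ℕ} {ω : Cell σ → R} (h : IsCochain σ k ω) (c : Cell σ)
    (hc : ¬ IsFace σ c) : ω c = 0 := by
  by_contra hne
  exact hc (h c hne).1

theorem IsCochain.delta {σ : Simp P} {k : ℕ} {ω : Cell σ → R} (h : IsCochain σ k ω) :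
    IsCochain σ (k + 1) (delta R σ ω) := by
  classical
  intro c hne
  have hc : IsFace σ c := by
    by_contra hn
    exact hne (delta_vanish σ ω c hn)
  refine ⟨hc, ?_⟩
  by_contra hcard
  refine hne ?_
  rw [delta_apply_of_vanish σ h.vanish c hc.1 hc.2.1, Finset.sum_eq_zero, Finset.sum_eq_zero,
    add_zero]
  · intro s hs
    have : ω (c.1, insert s c.2) = 0 := by
      by_contra hn
      have h2 := (h _ hn).2
      rw [Finset.card_insert_of_notMem (Finset.mem_sdiff.1 hs).2] at h2
      exact hcard (by rw [h2]; ring)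
    rw [this, mul_zero]
  · intro i hi
    have : ω (c.1.erase i, c.2) = 0 := by
      by_contra hn
      have h2 := (h _ hn).2
      have h3 := Finset.card_erase_add_one hi
      exact hcard (by rw [← h3]; simp only at h2; rw [h2]; ring)
    rw [this, mul_zero]

theorem delta_mem (p : Perversity P) (σ : Simp P) {k : ℕ} {ω : Cell σ → R}
    (h : ω ∈ intersectionCochains R p σ k) :
    delta R σ ω ∈ intersectionCochains R p σ (k + 1) :=
  ⟨h.1.delta, h.2.2, by
    rw [delta_delta σ h.1.vanish]
    exact fun s c h => absurd rfl h⟩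

theorem pullback_mem (p : Perversity P) {σ τ : Simp P} (θ : σ ⟶ τ) {k : ℕ} {ω : Cell τ → R}
    (h : ω ∈ intersectionCochains R p τ k) :
    pullback R θ ω ∈ intersectionCochains R p σ k := by
  have key : ∀ η : Cell τ → R, Allowable p τ η → Allowable p σ (pullback R θ η) := by
    intro η hη s c hne
    obtain ⟨hi, hne'⟩ := pullback_ne_zero θ hne
    rw [← perverseDegree_image θ c hi s]
    exact hη s _ hne'
  refine ⟨h.1.pullback θ, key _ h.2.1, ?_⟩
  rw [delta_pullback θ h.1.vanish]
  exact key _ h.2.2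

variable (R) in
/-- The cochain complex `Ñ*_p(Δ[σ]; R)`. -/
noncomputable def intersectionComplex (p : Perversity P) (σ : Simp P) :
    CochainComplex (ModuleCat.{u} R) ℕ where
  X k := ModuleCat.of R (intersectionCochains R p σ k)
  d i j :=
    if h : i + 1 = j then
      ModuleCat.ofHom ((delta R σ).restrict fun _ hω => h ▸ delta_mem p σ hω)
    else 0
  shape i j h := dif_neg h
  d_comp_d' i j k hij hjk := by
    obtain rfl : i + 1 = j := hij
    obtain rfl : i + 1 + 1 = k := hjk
    simp only [dif_pos]
    exact ModuleCat.hom_ext <| LinearMap.ext fun ω => Subtype.ext (delta_delta σ ω.2.1.vanish)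

variable (R) in
/-- The functor `Ñ*_p : Δ[P]ᵒᵖ ⥤ M_dg`, `σ ↦ Ñ*_p(Δ[σ]; R)`. -/
noncomputable def intersectionFunctor (p : Perversity P) :
    (Simp P)ᵒᵖ ⥤ CochainComplex (ModuleCat.{u} R) ℕ where
  obj σ := intersectionComplex R p σ.unop
  map θ :=
    { f := fun k => ModuleCat.ofHom
        ((pullback R θ.unop).restrict fun _ hω => pullback_mem p θ.unop hω)
      comm' := fun i j hij => by
        obtain rfl : i + 1 = j := hij
        simp only [intersectionComplex, dif_pos]
        exact ModuleCat.hom_ext <| LinearMap.ext fun ω =>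
          Subtype.ext (delta_pullback θ.unop ω.2.1.vanish) }
  map_id σ := by
    ext k ω
    exact Subtype.ext (pullback_id ω.1)
  map_comp θ η := by
    ext k ω
    exact Subtype.ext (pullback_comp η.unop θ.unop ω.1)

/-! ### Cochains on presheaves, and the adjoint functor -/

section Adjunction

variable {C : Type u} [Category.{v} C] (A : Cᵒᵖ ⥤ CochainComplex (ModuleCat.{u} R) ℕ)

/-- The module `Hom(L, Aᵏ)` of natural families `ω_σ(x) ∈ Aᵏ(σ)`, for `σ` in `C` and
`x ∈ L(σ)`. -/
def naturalFamilies (L : Cᵒᵖ ⥤ Type u) (k : ℕ) :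
    Submodule R (∀ σ : Cᵒᵖ, L.obj σ → (A.obj σ).X k) where
  carrier := {ω | ∀ ⦃σ τ : Cᵒᵖ⦄ (θ : σ ⟶ τ) (x : L.obj σ),
    ω τ (L.map θ x) = (A.map θ).f k (ω σ x)}
  zero_mem' := fun _ _ _ _ => (map_zero _).symm
  add_mem' := fun {ω η} hω hη σ τ θ x => by
    rw [Pi.add_apply, Pi.add_apply, Pi.add_apply, Pi.add_apply, map_add, hω, hη]
  smul_mem' := fun a ω hω σ τ θ x => by
    rw [Pi.smul_apply, Pi.smul_apply, Pi.smul_apply, Pi.smul_apply, map_smul, hω]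

/-- The cochain complex `Hom(L, A*)` of a presheaf `L` on `C`, for a presheaf `A` of cochain
complexes. -/
def cochains (L : Cᵒᵖ ⥤ Type u) : CochainComplex (ModuleCat.{u} R) ℕ where
  X k := ModuleCat.of R (naturalFamilies A L k)
  d i j := ModuleCat.ofHom
    { toFun := fun ω => ⟨fun σ x => (A.obj σ).d i j (ω.1 σ x), fun σ τ θ x => by
        refine (congrArg ((A.obj τ).d i j) (ω.2 θ x)).trans ?_
        exact ConcreteCategory.congr_hom ((A.map θ).comm i j) (ω.1 σ x)⟩
      map_add' := fun ω η => Subtype.ext <| funext fun σ => funext fun x => map_add _ _ _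
      map_smul' := fun a ω => Subtype.ext <| funext fun σ => funext fun x => map_smul _ _ _ }
  shape i j h := by
    refine ModuleCat.hom_ext <| LinearMap.ext fun ω =>
      Subtype.ext <| funext fun σ => funext fun x => ?_
    exact ConcreteCategory.congr_hom ((A.obj σ).shape i j h) (ω.1 σ x)
  d_comp_d' i j k _ _ := by
    refine ModuleCat.hom_ext <| LinearMap.ext fun ω =>
      Subtype.ext <| funext fun σ => funext fun x => ?_
    exact ConcreteCategory.congr_hom ((A.obj σ).d_comp_d i j k) (ω.1 σ x)

/-- The cochain map `Hom(L, A*) → Hom(L', A*)` induced by a morphism `L' ⟶ L`. -/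
def cochainsMap {L' L : Cᵒᵖ ⥤ Type u} (f : L' ⟶ L) : cochains A L ⟶ cochains A L' where
  f k := ModuleCat.ofHom
    { toFun := fun ω => ⟨fun σ x => ω.1 σ (f.app σ x), fun σ τ θ x => by
        rw [← ω.2 θ]
        exact congrArg (ω.1 τ) (ConcreteCategory.congr_hom (f.naturality θ) x)⟩
      map_add' := fun _ _ => rfl
      map_smul' := fun _ _ => rfl }
  comm' _ _ _ := rfl

/-- The presheaf `σ ↦ Hom_{M_dg}(M, A(σ))`. -/
def realize (M : CochainComplex (ModuleCat.{u} R) ℕ) : Cᵒᵖ ⥤ Type u where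
  obj σ := M ⟶ A.obj σ
  map θ := TypeCat.ofHom fun g => g ≫ A.map θ
  map_id σ := by
    refine ConcreteCategory.hom_ext _ _ fun g => ?_
    exact (congrArg (g ≫ ·) (A.map_id σ)).trans (Category.comp_id g)
  map_comp θ η := by
    refine ConcreteCategory.hom_ext _ _ fun g => ?_
    exact (congrArg (g ≫ ·) (A.map_comp θ η)).trans (Category.assoc g _ _).symm

/-- The adjunction bijection `Hom(L, ⟨M⟩) ≃ Hom_{M_dg}(M, Hom(L, A*))`,
`β(Φ)(w)(x) = Φ(x)(w)`. -/
def adj (L : Cᵒᵖ ⥤ Type u) (M : CochainComplex (ModuleCat.{u} R) ℕ) :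
    (L ⟶ realize A M) ≃ (M ⟶ cochains A L) where
  toFun Φ :=
    { f := fun k => ModuleCat.ofHom
        { toFun := fun w => ⟨fun σ x => HomologicalComplex.Hom.f (Φ.app σ x : M ⟶ A.obj σ) k w,
            fun σ τ θ x => by
              have h : (Φ.app τ (L.map θ x) : M ⟶ A.obj τ) =
                (Φ.app σ x : M ⟶ A.obj σ) ≫ A.map θ :=
                ConcreteCategory.congr_hom (Φ.naturality θ) x
              exact congrArg (fun g : M ⟶ A.obj τ => g.f k w) h⟩
          map_add' := fun _ _ => Subtype.ext <| funext fun σ => funext fun x => map_add _ _ _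
          map_smul' := fun _ _ =>
            Subtype.ext <| funext fun σ => funext fun x => map_smul _ _ _ }
      comm' := fun i j _ => by
        ext w
        refine Subtype.ext <| funext fun σ => funext fun x => ?_
        exact ConcreteCategory.congr_hom
          (HomologicalComplex.Hom.comm (Φ.app σ x : M ⟶ A.obj σ) i j) w }
  invFun g :=
    { app := fun σ => TypeCat.ofHom fun x => show M ⟶ A.obj σ from
        { f := fun k => ModuleCat.ofHom
            { toFun := fun w => (g.f k w).1 σ x
              map_add' := fun a b => by rw [map_add]; rfl
              map_smul' := fun a b => by rw [map_smul]; rfl }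
          comm' := fun i j _ => by
            ext w
            exact congrFun (congrFun (congrArg Subtype.val
              (ConcreteCategory.congr_hom (g.comm i j) w)) σ) x }
      naturality := fun σ τ θ => by
        ext x
        refine HomologicalComplex.hom_ext (C := M) (D := A.obj τ) _ _ fun k => ?_
        ext w
        exact (g.f k w).2 θ x }
  left_inv Φ := by
    ext σ x
    rfl
  right_inv g := by
    ext k w
    rfl

end Adjunction

/-! ### The simplicial structure on presheaves over a category with a functor to `Δ` -/

section Simplicial

variable {C : Type u} [Category.{v} C] (D : C ⥤ SimplexCategory)

/-- The tensor product `K ⊗ X` of a presheaf `K` on `C` with a simplicial set `X`: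
`(K ⊗ X)(σ) = K(σ) × Xₘ` if `D σ = [m]`. -/
def tensor (K : Cᵒᵖ ⥤ Type u) (X : SSet.{u}) : Cᵒᵖ ⥤ Type u :=
  FunctorToTypes.prod K (D.op ⋙ X)

/-- Functoriality of `K ⊗ X` in `X`. -/
def tensorMap (K : Cᵒᵖ ⥤ Type u) {X Y : SSet.{u}} (f : X ⟶ Y) : tensor D K X ⟶ tensor D K Y where
  app σ := TypeCat.ofHom fun a => (a.1, f.app (D.op.obj σ) a.2)
  naturality σ τ θ := by
    refine ConcreteCategory.hom_ext _ _ fun a => ?_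
    have h := ConcreteCategory.congr_hom (f.naturality (D.op.map θ)) (a.2 : X.obj (D.op.obj σ))
    exact Prod.ext rfl h

/-- Functoriality of `K ⊗ X` in `K`. -/
def tensorMapLeft {K K' : Cᵒᵖ ⥤ Type u} (f : K' ⟶ K) (X : SSet.{u}) :
    tensor D K' X ⟶ tensor D K X where
  app σ := TypeCat.ofHom fun a => (f.app σ a.1, a.2)
  naturality σ τ θ := by
    refine ConcreteCategory.hom_ext _ _ fun a => ?_
    have h := ConcreteCategory.congr_hom (f.naturality θ) (a.1 : K'.obj σ)
    exact Prod.ext h rfl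

/-- The simplicial mapping space `Hom^Δ(K, B)`, with `Hom^Δ(K, B)ₙ = Hom(K ⊗ Δ[n], B)`. -/
def mapSpace (K B : Cᵒᵖ ⥤ Type u) : SSet.{u} where
  obj n := tensor D K (SSet.stdSimplex.{u}.obj n.unop) ⟶ B
  map θ := TypeCat.ofHom fun H => tensorMap D K (SSet.stdSimplex.{u}.map θ.unop) ≫ H
  map_id n := by
    refine ConcreteCategory.hom_ext _ _ fun H => ?_
    exact (congrArg (· ≫ H) (congrArg (tensorMap D K) (SSet.stdSimplex.{u}.map_id _))).trans
      (Category.id_comp H)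
  map_comp θ η := by
    refine ConcreteCategory.hom_ext _ _ fun H => ?_
    exact (congrArg (· ≫ H)
      (congrArg (tensorMap D K) (SSet.stdSimplex.{u}.map_comp η.unop θ.unop))).trans
      (Category.assoc (tensorMap D K (SSet.stdSimplex.{u}.map η.unop))
        (tensorMap D K (SSet.stdSimplex.{u}.map θ.unop)) H)

/-- `B` is s-fibrant if `Hom^Δ(Z, B)` is a Kan complex for all `Z`. -/
def SFibrant (B : Cᵒᵖ ⥤ Type u) : Prop :=
  ∀ Z : Cᵒᵖ ⥤ Type u, SSet.KanComplex (mapSpace D Z B)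

/-- The set of homotopy classes `[K, B] = π₀ Hom^Δ(K, B)`. -/
def HtpyClasses (K B : Cᵒᵖ ⥤ Type u) : Type u := SSet.π₀ (mapSpace D K B)

/-- The homotopy class of a morphism `Φ : K ⟶ B`, seen as the vertex `K ⊗ Δ[0] ≅ K ⟶ B` of
`Hom^Δ(K, B)`. -/
def htpyClass {K B : Cᵒᵖ ⥤ Type u} (Φ : K ⟶ B) : HtpyClasses D K B :=
  SSet.π₀.mk (X := mapSpace D K B)
    ((FunctorToTypes.prod.fst : tensor D K (Δ[0] : SSet.{u}) ⟶ K) ≫ Φ)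

/-- The map of mapping spaces `Hom^Δ(K, B) → Hom^Δ(K', B)` given by composition with
`f : K' ⟶ K`. -/
def mapSpacePrecomp {K K' : Cᵒᵖ ⥤ Type u} (f : K' ⟶ K) (B : Cᵒᵖ ⥤ Type u) :
    mapSpace D K B ⟶ mapSpace D K' B where
  app n := TypeCat.ofHom fun H => tensorMapLeft D f (SSet.stdSimplex.{u}.obj n.unop) ≫ H
  naturality _ _ _ := rfl

/-- The map `[K, B] → [K', B]`, `[Φ] ↦ [Φ ∘ f]` induced by `f : K' ⟶ K`. -/
def htpyPrecomp {K K' : Cᵒᵖ ⥤ Type u} (f : K' ⟶ K) (B : Cᵒᵖ ⥤ Type u) :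
    HtpyClasses D K B → HtpyClasses D K' B :=
  SSet.mapπ₀ (mapSpacePrecomp D f B)

theorem htpyPrecomp_htpyClass {K K' B : Cᵒᵖ ⥤ Type u} (f : K' ⟶ K) (Φ : K ⟶ B) :
    htpyPrecomp D f B (htpyClass D Φ) = htpyClass D (f ≫ Φ) := rfl

end Simplicial

/-! ### The categories of simplicial sets over a poset and the two functors -/

variable (P) in
/-- The category `Sset_P` of simplicial sets over `P`: presheaves on `Δ[P]`. -/
abbrev SsetOver := (Simp P)ᵒᵖ ⥤ Type u

variable (P) in
/-- The category `Sset_P⁺` of restricted simplicial sets over `P`: presheaves on `Δ[P]⁺`.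
In its simplicial structure, `(K ⊗ X)(σ) = K(σ) × X_{dim σ}`; this is the restriction to `Δ[P]⁺`
of the tensor product in `Sset_P` of `X` with any extension of `K`, for example with the left Kan
extension of `K`. -/
abbrev SsetOverReg := (RegSimp P)ᵒᵖ ⥤ Type u

variable (P) in
/-- The functor `Δ[P]⁺ ⥤ Δ` that forgets the chain. -/
abbrev RegSimp.shape : RegSimp P ⥤ SimplexCategory := RegSimp.incl P ⋙ Simp.shape P

variable (R) in
/-- The restriction `Δ[P]⁺ᵒᵖ ⥤ M_dg` of the functor `σ ↦ Ñ*_p(Δ[σ]; R)`. -/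
noncomputable abbrev intersectionFunctorReg (p : Perversity P) :
    (RegSimp P)ᵒᵖ ⥤ CochainComplex (ModuleCat.{u} R) ℕ :=
  (RegSimp.incl P).op ⋙ intersectionFunctor R p

variable (R) in
/-- The blown up cochain complex `Ñ*_p(L; R)` of a simplicial set `L` over `P`. -/
noncomputable abbrev blownUp (p : Perversity P) (L : SsetOver P) :
    CochainComplex (ModuleCat.{u} R) ℕ :=
  cochains (intersectionFunctor R p) L

variable (R) in
/-- The blown up cochain complex `Ñ⁺*_p(K; R)` of a restricted simplicial set `K` over `P`. -/
noncomputable abbrev blownUpReg (p : Perversity P) (K : SsetOverReg P) :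
    CochainComplex (ModuleCat.{u} R) ℕ :=
  cochains (intersectionFunctorReg R p) K

/-- The simplicial set `⟨M⟩_p` over `P`, `⟨M⟩_p(σ) = Hom_{M_dg}(M, Ñ*_p(Δ[σ]; R))`. -/
noncomputable abbrev bracket (p : Perversity P) (M : CochainComplex (ModuleCat.{u} R) ℕ) :
    SsetOver P :=
  realize (intersectionFunctor R p) M

/-- The restricted simplicial set `⟨M⟩⁺_p` over `P`. -/
noncomputable abbrev bracketReg (p : Perversity P) (M : CochainComplex (ModuleCat.{u} R) ℕ) :
    SsetOverReg P :=
  realize (intersectionFunctorReg R p) M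

/-- The set `[M, N]` of homotopy classes of cochain maps (modulo cochain homotopy): the morphisms
of the homotopy category of cochain complexes. -/
abbrev CochainHtpyClasses (M N : CochainComplex (ModuleCat.{u} R) ℕ) :=
  (HomotopyCategory.quotient (ModuleCat.{u} R) (ComplexShape.up ℕ)).obj M ⟶
    (HomotopyCategory.quotient (ModuleCat.{u} R) (ComplexShape.up ℕ)).obj N

/-- The homotopy class of a cochain map. -/
abbrev cochainHtpyClass {M N : CochainComplex (ModuleCat.{u} R) ℕ} (f : M ⟶ N) :
    CochainHtpyClasses M N :=
  (HomotopyCategory.quotient (ModuleCat.{u} R) (ComplexShape.up ℕ)).map f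

variable (R) in
/-- The complex `R(n)`: the module `R` in degree `n` and zero in the other degrees. -/
noncomputable abbrev singleComplex (n : ℕ) : CochainComplex (ModuleCat.{u} R) ℕ :=
  (HomologicalComplex.single (ModuleCat.{u} R) (ComplexShape.up ℕ) n).obj (ModuleCat.of R R)

variable (R) in
/-- The cohomology class in `Hⁿ(R(n))` of the generator `1` of `R(n)`. -/
noncomputable def generatorClass (n : ℕ) : (singleComplex R n).homology n :=
  (HomologicalComplex.singleObjHomologySelfIso (ComplexShape.up ℕ) n (ModuleCat.of R R)).inv
    (1 : R)

variable (R) in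
/-- The perverse Eilenberg-MacLane simplicial set `K(R, n, P, p) = ⟨R(n)⟩_p`. -/
noncomputable abbrev EML (p : Perversity P) (n : ℕ) : SsetOver P := bracket p (singleComplex R n)

variable (R) in
/-- The perverse Eilenberg-MacLane restricted simplicial set `K(R, n, P, p)⁺ = ⟨R(n)⟩⁺_p`. -/
noncomputable abbrev EMLReg (p : Perversity P) (n : ℕ) : SsetOverReg P :=
  bracketReg p (singleComplex R n)

end BlownUp

/-! Fibrancy: by the adjunction, the n-simplices of `Hom^Δ(Z, ⟨M⟩)` are the cochain maps `M → Ñ*(Z ⊗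
Δ[n])`. They form an abelian group, the structure maps are additive, and a simplicial abelian group
is a Kan complex (`kanComplex_of_map_add`).

Bijections: a homotopy `L ⊗ Δ[1] → ⟨M⟩` is the same thing as a cochain map `M → Ñ*(L ⊗ Δ[1])`. Two
properties of the coefficient presheaf then suffice. `IsHomotopyInvariant` turns simplicial
homotopies into cochain homotopies, so the map on classes is well defined. `IsExtendable` gives
injectivity: if `Ψ - Φ = dh + hd`, `pr` is the projection `L ⊗ Δ[1] → L` and `T` extends cochains
from the vertex 1 by something vanishing at the vertex 0, then `pr*Φ + d(Th) + (Th)d` is a cochain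
map that restricts to `Φ` and `Ψ` at the two ends; `T` need not commute with `d`. Surjectivity is
the adjunction itself. For `M = R(n)`, cochain maps are n-cocycles and homotopic ones differ by
coboundaries, whence cohomology.

Extendability (`extendByZero_mem`): keep a cochain on the cells whose vertices all have level 1 and
put zero elsewhere. The new terms of the coboundary sit on cells with one extra vertex of level 0.
That vertex comes first in the chain, so it contributes nothing to the dimensions above a stratum,
and perverse degrees do not change.

Homotopy invariance (`delta_prismInt`, `prismInt_mem`): this is the prism operator, an alternating
sum over the simplices obtained by doubling one vertex. Doubling can only raise the perverse degree,
so integrals of allowable cochains are allowable; the coboundary of an integral is then controlled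
by the homotopy formula itself.

The prism argument is written for a fully faithful functor to `Δ[P]` whose essential image contains
the doubled simplices. The identity of `Δ[P]` and the inclusion of `Δ[P]⁺` are the two cases needed.
-/

namespace BlownUp

/-! ### Simplicial abelian groups are Kan complexes -/

section Kan

variable {X : SSet.{u}} [∀ n, AddCommGroup (X.obj n)]
  (hX : ∀ {m n : SimplexCategoryᵒᵖ} (θ : m ⟶ n) (x y : X.obj m),
    X.map θ (x + y) = X.map θ x + X.map θ y)
include hX

/-- One step in the construction of a filler in a simplicial abelian group: if the faces of `w`
with index in `S` are the prescribed ones, then `w` can be corrected so that its face of index `r`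
is the prescribed one too, provided that `r` is one of the two indices whose face map is a
retraction of the degeneracy `a` and that these two indices are not in `S`. -/
theorem exists_filler_insert {n : ℕ} (y : Fin (n + 3) → X _⦋n + 1⦌) (S : Set (Fin (n + 3)))
    (r : Fin (n + 3)) (a : Fin (n + 2)) (hr : r = a.castSucc ∨ r = a.succ)
    (hS : ∀ j ∈ S, j < a.castSucc ∨ a.succ < j)
    (hlt : ∀ j ∈ S, ∀ h : j < r,
      X.δ (r.pred (Fin.ne_zero_of_lt h)) (y j) = X.δ (j.castPred (Fin.ne_last_of_lt h)) (y r))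
    (hgt : ∀ j ∈ S, ∀ h : r < j,
      X.δ (j.pred (Fin.ne_zero_of_lt h)) (y r) = X.δ (r.castPred (Fin.ne_last_of_lt h)) (y j))
    (w : X _⦋n + 2⦌) (hw : ∀ j ∈ S, X.δ j w = y j) :
    ∃ w' : X _⦋n + 2⦌, X.δ r w' = y r ∧ ∀ j ∈ S, X.δ j w' = y j := by
  have hsub : ∀ {m n : SimplexCategoryᵒᵖ} (θ : m ⟶ n) (x y : X.obj m),
      X.map θ (x - y) = X.map θ x - X.map θ y := fun θ x y => by
    rw [eq_sub_iff_add_eq, ← hX, sub_add_cancel]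
  have hzero : ∀ {m n : SimplexCategoryᵒᵖ} (θ : m ⟶ n), X.map θ 0 = 0 := fun θ => by
    rw [← sub_self 0, hsub, sub_self]
  -- The error at face `r` is added back through the degeneracy `a`, of which face `r` is a
  -- retraction. For `j ∈ S` the face passes through the degeneracy and hits the error, whose face
  -- is zero by the compatibility of the `y`'s and `X.δ j w = y j`.
  refine ⟨w + X.σ a (y r - X.δ r w), ?_, fun j hj => ?_⟩
  · have : X.δ r (X.σ a (y r - X.δ r w)) = y r - X.δ r w := by
      rcases hr with rfl | rfl
      · exact SSet.δ_comp_σ_self_apply a _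
      · exact SSet.δ_comp_σ_succ_apply a _
    refine (hX _ _ _).trans ((congrArg (X.δ r w + ·) this).trans ?_)
    abel
  · suffices h : X.δ j (X.σ a (y r - X.δ r w)) = 0 by
      refine (hX _ _ _).trans ((congrArg (X.δ j w + ·) h).trans ?_)
      rw [add_zero, hw j hj]
    rcases hS j hj with h | h
    · have hjr : j < r := by
        rcases hr with rfl | rfl
        · exact h
        · exact h.trans a.castSucc_lt_succ
      obtain ⟨j, rfl⟩ := j.eq_castSucc_of_ne_last (Fin.ne_last_of_lt hjr)
      obtain ⟨a, rfl⟩ := a.eq_succ_of_ne_zero (Fin.ne_zero_of_lt (Fin.castSucc_lt_castSucc_iff.1 h))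
      have e : X.δ j (y r - X.δ r w) = 0 := by
        refine (hsub _ _ _).trans (sub_eq_zero.2 ?_)
        have e1 := hlt _ hj hjr
        rw [Fin.castPred_castSucc] at e1
        refine e1.symm.trans ?_
        rw [← hw _ hj]
        exact (SSet.δ_comp_δ'_apply hjr w).symm
      rw [SSet.δ_comp_σ_of_le_apply (Fin.le_castSucc_iff.2 (Fin.castSucc_lt_castSucc_iff.1 h)), e]
      exact hzero _
    · have hjr : r < j := by
        rcases hr with rfl | rfl
        · exact a.castSucc_lt_succ.trans h
        · exact h
      obtain ⟨j, rfl⟩ := j.eq_succ_of_ne_zero (Fin.ne_zero_of_lt hjr)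
      obtain ⟨a, rfl⟩ := a.eq_castSucc_of_ne_last (Fin.ne_last_of_lt (Fin.succ_lt_succ_iff.1 h))
      have e : X.δ j (y r - X.δ r w) = 0 := by
        refine (hsub _ _ _).trans (sub_eq_zero.2 ?_)
        have e1 := hgt _ hj hjr
        rw [Fin.pred_succ] at e1
        refine e1.trans ?_
        rw [← hw _ hj]
        exact SSet.δ_comp_δ'_apply (i := r.castPred (Fin.ne_last_of_lt hjr)) (j := j.succ) hjr w
      rw [SSet.δ_comp_σ_of_gt_apply (Fin.succ_lt_succ_iff.1 h), e]
      exact hzero _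

/-- Faces are corrected one at a time, in an order in which no correction disturbs a settled face:
upwards from `0` to `i - 1`, using the degeneracy `r` for face `r`, then downwards from `n + 2` to
`i + 1`, using the degeneracy `r - 1`. -/
theorem exists_filler {n : ℕ} (i : Fin (n + 3)) (y : Fin (n + 3) → X _⦋n + 1⦌)
    (hy : ∀ (j k : Fin (n + 3)) (_ : j ≠ i) (_ : k ≠ i) (h : j < k),
      X.δ (k.pred (Fin.ne_zero_of_lt h)) (y j) = X.δ (j.castPred (Fin.ne_last_of_lt h)) (y k)) :
    ∃ w : X _⦋n + 2⦌, ∀ j ≠ i, X.δ j w = y j := by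
  have below : ∀ r : ℕ, r ≤ i.1 → ∃ w : X _⦋n + 2⦌, ∀ j : Fin (n + 3), j.1 < r →
      X.δ j w = y j := by
    intro r
    induction r with
    | zero => exact fun _ => ⟨0, fun j hj => absurd hj (Nat.not_lt_zero _)⟩
    | succ r ih =>
      intro hr
      obtain ⟨w, hw⟩ := ih (by omega)
      have hi := i.2
      obtain ⟨w', h1, h2⟩ := exists_filler_insert hX y {j | j.1 < r} ⟨r, by omega⟩ ⟨r, by omega⟩
        (Or.inl rfl) (fun j hj => Or.inl hj)
        (fun j hj h => hy j _ (fun e => by subst e; simp at hj; omega)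
          (fun e => by rw [Fin.ext_iff] at e; simp at e; omega) h)
        (fun j hj h => absurd (Fin.lt_def.1 h) (by simp at hj ⊢; omega)) w hw
      refine ⟨w', fun j hj => ?_⟩
      rcases Nat.lt_succ_iff_lt_or_eq.1 hj with h | h
      · exact h2 j h
      · have e : j = ⟨r, by omega⟩ := Fin.ext h
        rw [e, h1]
  have above : ∀ r : ℕ, r ≤ n + 2 - i.1 → ∃ w : X _⦋n + 2⦌, ∀ j : Fin (n + 3),
      (j < i ∨ n + 2 < j.1 + r) → X.δ j w = y j := by
    intro r
    induction r with
    | zero =>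
      intro _
      obtain ⟨w, hw⟩ := below i.1 le_rfl
      exact ⟨w, fun j hj => hw j (hj.elim id fun h => absurd h (by omega))⟩
    | succ r ih =>
      intro hr
      obtain ⟨w, hw⟩ := ih (by omega)
      -- The bound on `r` gives `i ≤ n + 1 - r`, so the faces below `i` stay strictly below the
      -- degeneracy index.
      obtain ⟨w', h1, h2⟩ := exists_filler_insert hX y {j | j < i ∨ n + 2 < j.1 + r}
        ⟨n + 2 - r, by omega⟩ ⟨n + 1 - r, by omega⟩
        (Or.inr (Fin.ext (by simp; omega)))
        (fun j hj => by
          rcases hj with h | h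
          · left; rw [Fin.lt_def] at h ⊢; simp; omega
          · right; rw [Fin.lt_def]; simp; omega)
        (fun j hj h => hy j _ (fun e => by
            subst e; rw [Fin.lt_def] at h; simp at hj h; omega)
          (fun e => by rw [Fin.ext_iff] at e; simp at e; omega) h)
        (fun j hj h => hy _ j (fun e => by rw [Fin.ext_iff] at e; simp at e; omega)
          (fun e => by subst e; rw [Fin.lt_def] at h; simp at hj h; omega) h) w hw
      refine ⟨w', fun j hj => ?_⟩
      by_cases h : j.1 = n + 2 - r
      · have e : j = ⟨n + 2 - r, by omega⟩ := Fin.ext h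
        rw [e, h1]
      · exact h2 j (hj.imp_right fun _ => by omega)
  obtain ⟨w, hw⟩ := above (n + 2 - i.1) le_rfl
  refine ⟨w, fun j hj => hw j ?_⟩
  rcases lt_or_gt_of_ne hj with h | h
  · exact Or.inl h
  · right; rw [Fin.lt_def] at h; omega

/-- A simplicial abelian group is a Kan complex. -/
theorem kanComplex_of_map_add : SSet.KanComplex X := by
  refine SSet.KanComplex.iff.2 fun n i f hf => ?_
  suffices h : ∃ w : X _⦋n + 1⦌, ∀ j (hj : j ≠ i), X.δ j w = SSet.yonedaEquiv (f j hj) by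
    obtain ⟨w, hw⟩ := h
    refine ⟨SSet.yonedaEquiv.symm w, fun j hj => SSet.yonedaEquiv.injective ?_⟩
    rw [SSet.stdSimplex.yonedaEquiv_δ_comp, Equiv.apply_symm_apply, hw j hj]
  cases n with
  -- A horn of `Δ[1]` is a single vertex; the degenerate edge on it is a filler.
  | zero =>
    have hu : ∀ j k : Fin 2, j ≠ i → k ≠ i → j = k := by omega
    obtain ⟨j, hj⟩ := exists_ne i
    refine ⟨X.σ 0 (SSet.yonedaEquiv (f j hj)), fun k hk => ?_⟩
    obtain rfl := hu j k hj hk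
    fin_cases j
    · exact SSet.δ_comp_σ_self_apply 0 _
    · exact SSet.δ_comp_σ_succ_apply 0 _
  | succ n =>
    classical
    obtain ⟨w, hw⟩ := exists_filler hX i
      (fun j => if hj : j ≠ i then SSet.yonedaEquiv (f j hj) else 0) (fun j k hj hk h => by
        rw [dif_pos hj, dif_pos hk, ← SSet.stdSimplex.yonedaEquiv_δ_comp,
          ← SSet.stdSimplex.yonedaEquiv_δ_comp]
        exact congrArg SSet.yonedaEquiv (hf j k hj hk h))
    exact ⟨w, fun j hj => (hw j hj).trans (dif_pos hj)⟩

end Kan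

/-! ### Homotopy classes of morphisms into `⟨M⟩` -/

section Realize

variable {R : Type u} [CommRing R] {C : Type u} [Category.{v} C] (D : C ⥤ SimplexCategory)
  (A : Cᵒᵖ ⥤ CochainComplex (ModuleCat.{u} R) ℕ)

theorem adj_comp {L L' : Cᵒᵖ ⥤ Type u} (f : L' ⟶ L) (M : CochainComplex (ModuleCat.{u} R) ℕ)
    (Φ : L ⟶ realize A M) : adj A L' M (f ≫ Φ) = adj A L M Φ ≫ cochainsMap A f := rfl

/-- `⟨M⟩` is s-fibrant: the mapping spaces into it are simplicial abelian groups. -/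
theorem sFibrant_realize (M : CochainComplex (ModuleCat.{u} R) ℕ) :
    SFibrant D (realize A M) := by
  intro Z
  -- The group structure is transported along the adjunction. Simplicial operators become
  -- composition with a fixed `cochainsMap`, which is additive.
  let e := fun n : SimplexCategoryᵒᵖ => adj A (tensor D Z (SSet.stdSimplex.{u}.obj n.unop)) M
  let _ : ∀ n, AddCommGroup ((mapSpace D Z (realize A M)).obj n) := fun n => (e n).addCommGroup
  refine kanComplex_of_map_add fun {m n} θ x y => (e n).injective ?_
  have hadd : ∀ n (x y : (mapSpace D Z (realize A M)).obj n), e n (x + y) = e n x + e n y :=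
    fun n x y => (e n).apply_symm_apply _
  have hmap : ∀ x : (mapSpace D Z (realize A M)).obj m,
      e n ((mapSpace D Z (realize A M)).map θ x) =
        e m x ≫ cochainsMap A (tensorMap D Z (SSet.stdSimplex.{u}.map θ.unop)) := fun x => rfl
  rw [hmap, hadd, hadd, hmap, hmap, Preadditive.add_comp]

/-- The inclusion `L → L ⊗ Δ[1]` at the vertex `ε` of `Δ[1]`. -/
def tensorIncl (L : Cᵒᵖ ⥤ Type u) (ε : Fin 2) : L ⟶ tensor D L (Δ[1] : SSet.{u}) where
  app _ := TypeCat.ofHom fun x => (x, SSet.stdSimplex.const 1 ε _)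
  naturality _ _ _ := rfl

/-- The indices cross because the coface `δ 1` omits the vertex 1, so its image is the vertex 0. -/
theorem fst_tensorIncl_zero (L : Cᵒᵖ ⥤ Type u) :
    (FunctorToTypes.prod.fst : tensor D L (Δ[0] : SSet.{u}) ⟶ L) ≫ tensorIncl D L 0 =
      tensorMap D L (SSet.stdSimplex.δ (1 : Fin 2)) := by
  rw [SSet.stdSimplex.δ_one_eq_const]
  rfl

theorem fst_tensorIncl_one (L : Cᵒᵖ ⥤ Type u) :
    (FunctorToTypes.prod.fst : tensor D L (Δ[0] : SSet.{u}) ⟶ L) ≫ tensorIncl D L 1 =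
      tensorMap D L (SSet.stdSimplex.δ (0 : Fin 2)) := by
  rw [SSet.stdSimplex.δ_zero_eq_const]
  rfl

/-- The isomorphism `L → L ⊗ Δ[0]`. -/
def toTensorPoint (L : Cᵒᵖ ⥤ Type u) : L ⟶ tensor D L (Δ[0] : SSet.{u}) where
  app _ := TypeCat.ofHom fun x => (x, SSet.stdSimplex.const 0 0 _)
  naturality _ _ _ := rfl

theorem fst_toTensorPoint (L : Cᵒᵖ ⥤ Type u) :
    (FunctorToTypes.prod.fst : tensor D L (Δ[0] : SSet.{u}) ⟶ L) ≫ toTensorPoint D L = 𝟙 _ := by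
  ext σ x
  refine Prod.ext rfl ?_
  exact (SSet.stdSimplex.objEquiv (n := ⦋0⦌)).injective (Subsingleton.elim _ _)

variable {L B : Cᵒᵖ ⥤ Type u}

theorem fst_toTensorPoint_comp (H : tensor D L (Δ[0] : SSet.{u}) ⟶ B) :
    (FunctorToTypes.prod.fst : tensor D L (Δ[0] : SSet.{u}) ⟶ L) ≫ toTensorPoint D L ≫ H = H := by
  exact (congrArg (· ≫ H) (fst_toTensorPoint D L)).trans (Category.id_comp H)

/-- The map from the set of morphisms `L ⟶ B` to the set of homotopy classes is surjective. -/
theorem htpyClass_surjective (x : HtpyClasses D L B) : ∃ Φ : L ⟶ B, htpyClass D Φ = x := by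
  obtain ⟨H, rfl⟩ := SSet.π₀.mk_surjective x
  exact ⟨toTensorPoint D L ≫ H, congrArg SSet.π₀.mk (fst_toTensorPoint_comp D H)⟩

theorem htpyClass_eq_of_homotopy (H : tensor D L (Δ[1] : SSet.{u}) ⟶ B) :
    htpyClass D (tensorIncl D L 0 ≫ H) = htpyClass D (tensorIncl D L 1 ≫ H) := by
  refine SSet.π₀.sound (SSet.Edge.mk H ?_ ?_)
  · exact congrArg (· ≫ H) (fst_tensorIncl_zero D L).symm
  · exact congrArg (· ≫ H) (fst_tensorIncl_one D L).symm

/-- A function on morphisms `L ⟶ B` that is invariant under homotopies `L ⊗ Δ[1] ⟶ B` descends to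
homotopy classes. -/
theorem exists_lift_htpyClasses {T : Type*} (g : (L ⟶ B) → T)
    (hg : ∀ H : tensor D L (Δ[1] : SSet.{u}) ⟶ B,
      g (tensorIncl D L 0 ≫ H) = g (tensorIncl D L 1 ≫ H)) :
    ∃ e : HtpyClasses D L B → T, ∀ Φ, e (htpyClass D Φ) = g Φ := by
  refine ⟨SSet.π₀.lift (X := mapSpace D L B) (fun H => g (toTensorPoint D L ≫ H)) ?_, ?_⟩
  -- An edge of the mapping space is by definition a morphism out of `L ⊗ Δ[1]`; its two ends are
  -- the restrictions along `tensorIncl`.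
  · intro H₀ H₁ e
    let H : tensor D L (Δ[1] : SSet.{u}) ⟶ B := e.edge
    have h0 : H₀ = FunctorToTypes.prod.fst ≫ tensorIncl D L 0 ≫ H := by
      rw [← Category.assoc, fst_tensorIncl_zero]
      exact e.src_eq.symm
    have h1 : H₁ = FunctorToTypes.prod.fst ≫ tensorIncl D L 1 ≫ H := by
      rw [← Category.assoc, fst_tensorIncl_one]
      exact e.tgt_eq.symm
    rw [h0, h1]
    exact hg H
  · intro Φ
    rfl

end Realize

/-! ### Cochain maps out of `R(n)` -/

section SingleComplex

variable {R : Type u} [CommRing R] {N : CochainComplex (ModuleCat.{u} R) ℕ} {n : ℕ}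

/-- Passes from classes to cocycles: a map out of `R(n)` is governed by the cocycle that is the
image of `1`. -/
theorem homologyMap_generatorClass (f : singleComplex R n ⟶ N) :
    HomologicalComplex.homologyMap f n (generatorClass R n) =
      N.homologyπ n (HomologicalComplex.cyclesMap f n
        ((HomologicalComplex.singleObjCyclesSelfIso (ComplexShape.up ℕ) n (ModuleCat.of R R)).inv
          (1 : R))) := by
  have h := HomologicalComplex.singleObjCyclesSelfIso_inv_homologyπ (ComplexShape.up ℕ) n
    (ModuleCat.of R R)
  rw [generatorClass, ← h]
  exact (ConcreteCategory.congr_hom (HomologicalComplex.homologyπ_naturality f n) _)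

theorem exists_homologyMap_generatorClass_eq (a : N.homology n) :
    ∃ f : singleComplex R n ⟶ N,
      HomologicalComplex.homologyMap f n (generatorClass R n) = a := by
  obtain ⟨z, rfl⟩ := (ModuleCat.epi_iff_surjective (N.homologyπ n)).1 inferInstance a
  let φ : ModuleCat.of R R ⟶ N.cycles n := ModuleCat.ofHom (LinearMap.toSpanSingleton R _ z)
  refine ⟨HomologicalComplex.mkHomFromSingle (φ ≫ N.iCycles n) fun k _ => by
    rw [Category.assoc, HomologicalComplex.iCycles_d, Limits.comp_zero], ?_⟩
  rw [homologyMap_generatorClass]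
  refine congrArg (N.homologyπ n) ?_
  have h : (HomologicalComplex.singleObjCyclesSelfIso (ComplexShape.up ℕ) n
      (ModuleCat.of R R)).inv ≫ HomologicalComplex.cyclesMap
        (HomologicalComplex.mkHomFromSingle (K := N) (c := ComplexShape.up ℕ) (φ ≫ N.iCycles n)
          fun k _ => by rw [Category.assoc, HomologicalComplex.iCycles_d, Limits.comp_zero]) n =
      φ := by
    rw [← cancel_mono (N.iCycles n)]
    simp
  refine (ConcreteCategory.congr_hom h (1 : R)).trans ?_
  exact one_smul R z

/-- The cocycles `f(1)` and `g(1)` differ by a coboundary `d y`, and `1 ↦ y` is the homotopy. -/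
theorem nonempty_homotopy_of_homologyMap_eq {f g : singleComplex R n ⟶ N}
    (h : HomologicalComplex.homologyMap f n (generatorClass R n) =
      HomologicalComplex.homologyMap g n (generatorClass R n)) : Nonempty (Homotopy f g) := by
  rw [homologyMap_generatorClass, homologyMap_generatorClass, ← sub_eq_zero, ← map_sub] at h
  have hex := (ShortComplex.moduleCat_exact_iff _).1
    (ShortComplex.exact_of_g_is_cokernel
      (ShortComplex.mk (N.toCycles ((ComplexShape.up ℕ).prev n) n) (N.homologyπ n) (by simp))
      (N.homologyIsCokernel _ n rfl))
  obtain ⟨y, hy⟩ := hex _ h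
  let u := (HomologicalComplex.singleObjXSelf (ComplexShape.up ℕ) n (ModuleCat.of R R)).inv (1 : R)
  have hu : ∀ f : singleComplex R n ⟶ N, N.iCycles n (HomologicalComplex.cyclesMap f n
        ((HomologicalComplex.singleObjCyclesSelfIso (ComplexShape.up ℕ) n (ModuleCat.of R R)).inv
          (1 : R))) = f.f n u := fun f => by
    have := (HomologicalComplex.singleObjCyclesSelfIso (ComplexShape.up ℕ) n
      (ModuleCat.of R R)).inv ≫= HomologicalComplex.cyclesMap_i f n
    rw [HomologicalComplex.singleObjCyclesSelfIso_inv_iCycles_assoc] at this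
    exact ConcreteCategory.congr_hom this (1 : R)
  have hd : N.d ((ComplexShape.up ℕ).prev n) n y = f.f n u - g.f n u := by
    rw [← hu, ← hu, ← map_sub, ← N.toCycles_i]
    exact congrArg (N.iCycles n) hy
  -- For `n = 0` there is no preceding degree: `prev` returns 0 and the differential from 0 to 0
  -- vanishes. The relation required in `k` makes the homotopy zero in that case.
  let m := (ComplexShape.up ℕ).prev n
  let φ : (singleComplex R n).X n ⟶ N.X m :=
    (HomologicalComplex.singleObjXSelf (ComplexShape.up ℕ) n (ModuleCat.of R R)).hom ≫
      ModuleCat.ofHom (LinearMap.toSpanSingleton R _ y)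
  let k : ∀ i j, (singleComplex R n).X i ⟶ N.X j := fun i j =>
    if h : i = n ∧ j = m ∧ (ComplexShape.up ℕ).Rel j i then
      eqToHom (by rw [h.1]) ≫ φ ≫ eqToHom (by rw [h.2.1]) else 0
  have hk : k n m ≫ N.d m n = φ ≫ N.d m n := by
    by_cases hr : (ComplexShape.up ℕ).Rel m n
    · simp only [k, dif_pos (⟨rfl, rfl, hr⟩ : n = n ∧ m = m ∧ (ComplexShape.up ℕ).Rel m n)]
      simp
    · rw [N.shape _ _ hr, Limits.comp_zero, Limits.comp_zero]
  have hfg : f - g = Homotopy.nullHomotopicMap k := by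
    refine HomologicalComplex.from_single_hom_ext ?_
    change f.f n - g.f n =
      (singleComplex R n).d n _ ≫ k _ n + k n m ≫ N.d m n
    rw [hk, HomologicalComplex.single_obj_d, Limits.zero_comp, zero_add]
    rw [← cancel_epi (HomologicalComplex.singleObjXSelf (ComplexShape.up ℕ) n
      (ModuleCat.of R R)).inv]
    refine ModuleCat.hom_ext (LinearMap.ext_ring ?_)
    refine hd.symm.trans ?_
    simp [φ, m]
  exact ⟨Homotopy.equivSubZero.symm ((Homotopy.ofEq hfg).trans
    (Homotopy.nullHomotopy k fun i j hij => dif_neg fun h => hij h.2.2))⟩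

end SingleComplex

/-! ### Representability, for a presheaf of cochain complexes with enough homotopies -/

section Representability

variable {R : Type u} [CommRing R] {C : Type u} [Category.{v} C] {D : C ⥤ SimplexCategory}
  {A : Cᵒᵖ ⥤ CochainComplex (ModuleCat.{u} R) ℕ}

variable (D A) in
/-- The two inclusions `L → L ⊗ Δ[1]` induce homotopic maps on `Hom(-, A*)`. -/
def IsHomotopyInvariant : Prop :=
  ∀ L : Cᵒᵖ ⥤ Type u, Nonempty (Homotopy
    (cochainsMap A (tensorIncl D L 0)) (cochainsMap A (tensorIncl D L 1)))

variable (D A) in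
/-- Every element of `Hom(L, Aᵏ)` can be extended, linearly, to an element of `Hom(L ⊗ Δ[1], Aᵏ)`
that is zero at the vertex `0` of `Δ[1]` and the given element at the vertex `1`. -/
def IsExtendable : Prop :=
  ∀ (L : Cᵒᵖ ⥤ Type u) (k : ℕ),
    ∃ T : (cochains A L).X k ⟶ (cochains A (tensor D L (Δ[1] : SSet.{u}))).X k,
      T ≫ (cochainsMap A (tensorIncl D L 0)).f k = 0 ∧
        T ≫ (cochainsMap A (tensorIncl D L 1)).f k = 𝟙 _

/-- By naturality of the adjunction, both ends of `H` are the one cochain map `adj A _ M H` followed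
by the two restrictions, which are homotopic. -/
theorem IsHomotopyInvariant.nonempty_homotopy (hA : IsHomotopyInvariant D A)
    {L : Cᵒᵖ ⥤ Type u} {M : CochainComplex (ModuleCat.{u} R) ℕ}
    (H : tensor D L (Δ[1] : SSet.{u}) ⟶ realize A M) :
    Nonempty (Homotopy (adj A L M (tensorIncl D L 0 ≫ H)) (adj A L M (tensorIncl D L 1 ≫ H))) :=
  (hA L).map fun h => h.compLeft (adj A _ M H)

/-- A null-homotopic map can be built from any degreewise family of maps, so inserting `T` after
`h.hom` still gives a cochain map. Its restriction is `0` at the vertex 0 and `dh + hd` at the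
vertex 1, hence `g` joins `Φ` to `Ψ`. -/
theorem IsExtendable.htpyClass_eq (hA : IsExtendable D A) {L : Cᵒᵖ ⥤ Type u}
    {M : CochainComplex (ModuleCat.{u} R) ℕ} {Φ Ψ : L ⟶ realize A M}
    (h : Homotopy (adj A L M Ψ) (adj A L M Φ)) : htpyClass D Φ = htpyClass D Ψ := by
  choose T hT0 hT1 using hA L
  let pr : tensor D L (Δ[1] : SSet.{u}) ⟶ L := FunctorToTypes.prod.fst
  let g : M ⟶ cochains A (tensor D L (Δ[1] : SSet.{u})) :=
    adj A L M Φ ≫ cochainsMap A pr +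
      Homotopy.nullHomotopicMap fun i j => h.hom i j ≫ T j
  have hg : ∀ ε, g ≫ cochainsMap A (tensorIncl D L ε) = adj A L M Φ +
      Homotopy.nullHomotopicMap fun i j =>
        h.hom i j ≫ T j ≫ (cochainsMap A (tensorIncl D L ε)).f j := fun ε => by
    rw [Preadditive.add_comp, Homotopy.nullHomotopicMap_comp]
    simp only [Category.assoc]
    rfl
  have h0 : g ≫ cochainsMap A (tensorIncl D L 0) = adj A L M Φ := by
    rw [hg]
    simp only [hT0, Limits.comp_zero]
    ext i : 1
    change (adj A L M Φ).f i + (M.d i _ ≫ 0 + 0 ≫ (cochains A L).d _ i) = _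
    simp
  have h1 : g ≫ cochainsMap A (tensorIncl D L 1) = adj A L M Ψ := by
    rw [hg]
    simp only [hT1, Category.comp_id]
    ext i : 1
    rw [h.comm i]
    exact add_comm _ _
  obtain ⟨H, hH⟩ := (adj A _ M).surjective g
  have e0 : tensorIncl D L 0 ≫ H = Φ := (adj A L M).injective (by rw [adj_comp, hH, h0])
  have e1 : tensorIncl D L 1 ≫ H = Ψ := (adj A L M).injective (by rw [adj_comp, hH, h1])
  rw [← e0, ← e1]
  exact htpyClass_eq_of_homotopy D H

/-- The adjunction induces a bijection `[L, ⟨M⟩] ≅ [M, Hom(L, A*)]`. -/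
theorem exists_htpyClasses_equiv (hA : IsHomotopyInvariant D A) (hA' : IsExtendable D A)
    (L : Cᵒᵖ ⥤ Type u) (M : CochainComplex (ModuleCat.{u} R) ℕ) :
    ∃ e : HtpyClasses D L (realize A M) ≃ CochainHtpyClasses M (cochains A L),
      ∀ Φ : L ⟶ realize A M, e (htpyClass D Φ) = cochainHtpyClass (adj A L M Φ) := by
  obtain ⟨e, he⟩ := exists_lift_htpyClasses D
    (fun Φ : L ⟶ realize A M => cochainHtpyClass (adj A L M Φ)) fun H =>
      (hA.nonempty_homotopy H).elim fun h => HomotopyCategory.eq_of_homotopy _ _ h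
  refine ⟨Equiv.ofBijective e ⟨fun x y hxy => ?_, fun y => ?_⟩, he⟩
  · obtain ⟨Φ, rfl⟩ := htpyClass_surjective D x
    obtain ⟨Ψ, rfl⟩ := htpyClass_surjective D y
    rw [he, he] at hxy
    exact hA'.htpyClass_eq (HomotopyCategory.homotopyOfEq _ _ hxy.symm)
  · obtain ⟨f, rfl⟩ := (HomotopyCategory.quotient (ModuleCat.{u} R) (ComplexShape.up ℕ)).map_surjective
      y
    obtain ⟨Φ, rfl⟩ := (adj A L M).surjective f
    exact ⟨htpyClass D Φ, he Φ⟩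

/-- `⟨R(n)⟩` represents the functor `L ↦ Hⁿ(Hom(L, A*))`. -/
theorem exists_htpyClasses_equiv_homology (hA : IsHomotopyInvariant D A)
    (hA' : IsExtendable D A) (n : ℕ) :
    ∃ e : ∀ L : Cᵒᵖ ⥤ Type u,
        (HtpyClasses D L (realize A (singleComplex R n)) ≃ (cochains A L).homology n),
      (∀ (L : Cᵒᵖ ⥤ Type u) (Φ : L ⟶ realize A (singleComplex R n)),
        e L (htpyClass D Φ) =
          HomologicalComplex.homologyMap (adj A L (singleComplex R n) Φ) n (generatorClass R n)) ∧
      ∀ (L L' : Cᵒᵖ ⥤ Type u) (f : L' ⟶ L)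
        (x : HtpyClasses D L (realize A (singleComplex R n))),
        e L' (htpyPrecomp D f (realize A (singleComplex R n)) x) =
          HomologicalComplex.homologyMap (cochainsMap A f) n (e L x) := by
  have key : ∀ L : Cᵒᵖ ⥤ Type u,
      ∃ e : HtpyClasses D L (realize A (singleComplex R n)) ≃ (cochains A L).homology n,
        ∀ Φ : L ⟶ realize A (singleComplex R n), e (htpyClass D Φ) =
          HomologicalComplex.homologyMap (adj A L (singleComplex R n) Φ) n
            (generatorClass R n) := fun L => by
    obtain ⟨e, he⟩ := exists_lift_htpyClasses D
      (fun Φ : L ⟶ realize A (singleComplex R n) =>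
        HomologicalComplex.homologyMap (adj A L (singleComplex R n) Φ) n (generatorClass R n))
      fun H => (hA.nonempty_homotopy H).elim fun h => by rw [h.homologyMap_eq n]
    refine ⟨Equiv.ofBijective e ⟨fun x y hxy => ?_, fun y => ?_⟩, he⟩
    · obtain ⟨Φ, rfl⟩ := htpyClass_surjective D x
      obtain ⟨Ψ, rfl⟩ := htpyClass_surjective D y
      rw [he, he] at hxy
      exact (nonempty_homotopy_of_homologyMap_eq hxy.symm).elim hA'.htpyClass_eq
    · obtain ⟨f, hf⟩ := exists_homologyMap_generatorClass_eq y
      obtain ⟨Φ, rfl⟩ := (adj A L _).surjective f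
      exact ⟨htpyClass D Φ, (he Φ).trans hf⟩
  choose e he using key
  refine ⟨e, he, fun L L' f x => ?_⟩
  obtain ⟨Φ, rfl⟩ := htpyClass_surjective D x
  rw [htpyPrecomp_htpyClass, he, he, adj_comp, HomologicalComplex.homologyMap_comp]
  rfl

end Representability

/-! ### Extension of blown up cochains from the vertex `1` of an interval -/

section Extension

variable {P : Type u} [PartialOrder P] {R : Type u} [CommRing R] {σ τ : Simp P}

open scoped Classical in
theorem delta_ne_zero {ω : Cell σ → R} {c : Cell σ} (h : delta R σ ω c ≠ 0) :
    IsFace σ c ∧ ((∃ i ∈ c.1, ω (c.1.erase i, c.2) ≠ 0) ∨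
      ∃ s ∈ c.1.image σ.chain \ c.2, ω (c.1, insert s c.2) ≠ 0) := by
  by_cases hc : IsFace σ c
  swap
  · exact absurd (delta_vanish σ ω c hc) h
  refine ⟨hc, ?_⟩
  by_contra! hn
  refine h ?_
  simp only [delta, LinearMap.coe_mk, AddHom.coe_mk, if_pos hc]
  rw [Finset.sum_eq_zero fun i hi => by rw [hn.1 i hi, mul_zero],
    Finset.sum_eq_zero fun s hs => by rw [hn.2 s hs, mul_zero], add_zero]

open scoped Classical in
variable (R) in
/-- The cochain that coincides with `ω` on the faces all of whose vertices have level `1`, and that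
vanishes on the other faces. -/
noncomputable def extendByZero (χ : Fin (σ.dom.len + 1) → Fin 2) :
    (Cell σ → R) →ₗ[R] (Cell σ → R) where
  toFun ω c := if ∀ i ∈ c.1, χ i = 1 then ω c else 0
  map_add' ω η := by
    ext c
    by_cases h : ∀ i ∈ c.1, χ i = 1
    · simp only [if_pos h, Pi.add_apply]
    · simp only [if_neg h, Pi.add_apply, add_zero]
  map_smul' a ω := by
    ext c
    by_cases h : ∀ i ∈ c.1, χ i = 1
    · simp only [if_pos h, Pi.smul_apply, RingHom.id_apply]
    · simp only [if_neg h, Pi.smul_apply, RingHom.id_apply, smul_zero]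

theorem extendByZero_apply (χ : Fin (σ.dom.len + 1) → Fin 2) (ω : Cell σ → R) (c : Cell σ)
    (h : ∀ i ∈ c.1, χ i = 1) : extendByZero R χ ω c = ω c := if_pos h

theorem extendByZero_ne_zero {χ : Fin (σ.dom.len + 1) → Fin 2} {ω : Cell σ → R} {c : Cell σ}
    (h : extendByZero R χ ω c ≠ 0) : (∀ i ∈ c.1, χ i = 1) ∧ ω c ≠ 0 := by
  by_cases hc : ∀ i ∈ c.1, χ i = 1
  · exact ⟨hc, by rwa [extendByZero_apply χ ω c hc] at h⟩
  · exact absurd (if_neg hc) h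

/-- The perverse degree along `s` counts only vertices in strata strictly above `s`. -/
theorem perverseDegree_erase_of_le {c : Cell σ} {i : Fin (σ.dom.len + 1)} {s : P}
    (hs : s ∈ c.2 → σ.chain i ≤ s) :
    perverseDegree σ (c.1.erase i, c.2) s = perverseDegree σ c s := by
  classical
  by_cases h : s ∈ c.2
  · simp only [perverseDegree, if_pos h, dimAbove]
    have : (c.1.erase i).filter (fun i => s < σ.chain i) = c.1.filter (fun i => s < σ.chain i) := by
      rw [Finset.filter_erase, Finset.erase_eq_of_notMem]
      exact fun h' => absurd (Finset.mem_filter.1 h').2 (hs h).not_gt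
    rw [this]
  · simp only [perverseDegree, if_neg h]

/-- On a cell with all vertices of level 1, the coboundary is that of `ω`. On another cell it can be
nonzero only if exactly one vertex `i` has level 0. Levels are monotone, so `i` precedes the other
vertices, and its stratum is at most every unconed one. Deleting `i` then preserves the perverse
degree, and allowability of `ω` itself gives the bound. -/
theorem extendByZero_mem (p : Perversity P) (χ : Fin (σ.dom.len + 1) →o Fin 2) {k : ℕ}
    {ω : Cell σ → R} (h : ω ∈ intersectionCochains R p σ k) :
    extendByZero R χ ω ∈ intersectionCochains R p σ k := by
  classical
  refine ⟨fun c hc => h.1 c (extendByZero_ne_zero hc).2,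
    fun s c hc => h.2.1 s c (extendByZero_ne_zero hc).2, fun s c hc => ?_⟩
  obtain ⟨hf, hne⟩ := delta_ne_zero hc
  by_cases hall : ∀ i ∈ c.1, χ i = 1
  · refine h.2.2 s c ?_
    convert hc using 1
    simp only [delta, LinearMap.coe_mk, AddHom.coe_mk, if_pos hf]
    congr 1
    · refine Finset.sum_congr rfl fun i _ => ?_
      rw [extendByZero_apply]
      exact fun j hj => hall j (Finset.mem_of_mem_erase hj)
    · refine Finset.sum_congr rfl fun t _ => ?_
      rw [extendByZero_apply]
      exact hall
  · rcases hne with ⟨i, hi, hne⟩ | ⟨t, _, hne⟩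
    swap
    · exact absurd (extendByZero_ne_zero hne).1 hall
    obtain ⟨h1, h2⟩ := extendByZero_ne_zero hne
    have hi0 : χ i = 0 := by
      by_contra hi1
      refine hall fun j hj => ?_
      by_cases hji : j = i
      · rw [hji]; omega
      · exact h1 j (Finset.mem_erase.2 ⟨hji, hj⟩)
    rw [← perverseDegree_erase_of_le (i := i)]
    · exact h.2.1 s _ h2
    · intro hs
      -- The unconed stratum `s` still contains a vertex `j` after `i` is deleted; `j` has level 1,
      -- so it cannot come before `i`.
      obtain ⟨j, hj, rfl⟩ := (h.1 _ h2).1.2.2 s hs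
      refine σ.chain.monotone ?_
      by_contra hlt
      have := χ.monotone (not_le.1 hlt).le
      rw [hi0, h1 j hj] at this
      exact absurd this (by decide)

theorem pullback_extendByZero (θ : σ ⟶ τ) (χ : Fin (τ.dom.len + 1) → Fin 2) (ω : Cell τ → R) :
    pullback R θ (extendByZero R χ ω) = extendByZero R (χ ∘ θ.map) (pullback R θ ω) := by
  ext c
  by_cases hi : Set.InjOn θ.map c.1
  · rw [pullback_apply θ _ c hi]
    by_cases h : ∀ i ∈ c.1, χ (θ.map i) = 1
    · rw [extendByZero_apply, extendByZero_apply (χ ∘ θ.map) _ _ h, pullback_apply θ _ c hi]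
      simpa using h
    · exact (if_neg (by simpa using h)).trans (if_neg h).symm
  · rw [pullback_apply_zero θ _ c hi]
    by_contra hne
    exact (extendByZero_ne_zero (Ne.symm hne)).2 (pullback_apply_zero θ _ c hi)

theorem extendByZero_one (ω : Cell σ → R) : extendByZero R (fun _ => 1) ω = ω := by
  ext c
  exact extendByZero_apply _ _ _ fun _ _ => rfl

/-- Every face has a vertex in its last factor, which is not coned, so no face satisfies the level
condition vacuously. -/
theorem extendByZero_zero {k : ℕ} {ω : Cell σ → R} (h : IsCochain σ k ω) :
    extendByZero R (fun _ => 0) ω = 0 := by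
  ext c
  by_contra hne
  obtain ⟨h1, h2⟩ := extendByZero_ne_zero hne
  obtain ⟨⟨_, ht, h3⟩, _⟩ := h c h2
  obtain ⟨i, hi, _⟩ := h3 _ ht
  exact absurd (h1 i hi) (by decide)

end Extension

/-! ### Doubling an element of a finite ordinal -/

section Doubling

variable {m n : ℕ}

/-- The faces omitting one or the other copy of `i` differ only at `i`. This makes the terms with `i
∉ F` drop out of the telescoping sum in `delta_prismInt`. -/
theorem succAbove_succ_eq {i j : Fin (n + 1)} (h : j ≠ i) :
    i.succ.succAbove j = i.castSucc.succAbove j := by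
  rcases lt_or_gt_of_ne h with h | h
  · rw [Fin.succAbove_of_castSucc_lt _ _ (Fin.castSucc_lt_castSucc_iff.2 h),
      Fin.succAbove_of_castSucc_lt _ _ (Fin.castSucc_lt_succ_iff.2 h.le)]
  · rw [Fin.succAbove_of_lt_succ _ _ (Fin.castSucc_lt_succ_iff.2 h.le),
      Fin.succAbove_of_lt_succ _ _ (Fin.succ_lt_succ_iff.2 h)]

theorem castSucc_succAbove_self (i : Fin (n + 1)) : i.castSucc.succAbove i = i.succ :=
  Fin.succAbove_of_lt_succ _ _ Fin.castSucc_lt_succ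

theorem succ_succAbove_self (i : Fin (n + 1)) : i.succ.succAbove i = i.castSucc :=
  Fin.succAbove_of_castSucc_lt _ _ Fin.castSucc_lt_succ

theorem predAbove_succ_succAbove (i j : Fin (n + 1)) :
    i.predAbove (i.succ.succAbove j) = j := by
  by_cases h : j = i
  · rw [h, succ_succAbove_self, Fin.predAbove_castSucc_self]
  · rw [succAbove_succ_eq h, Fin.predAbove_succAbove]

theorem castSucc_succAbove_val_lt_iff (i j : Fin (n + 1)) :
    (i.castSucc.succAbove j).1 < i.1 + 1 ↔ j.1 < i.1 := by
  rcases lt_or_ge j i with h | h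
  · rw [Fin.succAbove_of_castSucc_lt _ _ (Fin.castSucc_lt_castSucc_iff.2 h), Fin.val_castSucc]
    omega
  · rw [Fin.succAbove_of_lt_succ _ _ (Fin.castSucc_lt_succ_iff.2 h), Fin.val_succ]
    omega

theorem succ_succAbove_val_lt_iff (i j : Fin (n + 1)) :
    (i.succ.succAbove j).1 < i.1 + 1 ↔ j.1 < i.1 + 1 := by
  rcases le_or_gt j i with h | h
  · rw [Fin.succAbove_of_castSucc_lt _ _ (Fin.castSucc_lt_succ_iff.2 h), Fin.val_castSucc]
  · rw [Fin.succAbove_of_lt_succ _ _ (Fin.succ_lt_succ_iff.2 h), Fin.val_succ]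
    omega

theorem eq_castSucc_or_eq_succ (i : Fin (n + 1)) (j : Fin (n + 2)) :
    (∃ k ≤ i, j = k.castSucc) ∨ ∃ k, i ≤ k ∧ j = k.succ := by
  by_cases h : j ≤ i.castSucc
  · exact Or.inl ⟨j.castPred (Fin.ne_last_of_lt (h.trans_lt Fin.castSucc_lt_succ)),
      by rwa [Fin.castPred_le_iff], by simp⟩
  · exact Or.inr ⟨j.pred (Fin.ne_zero_of_lt (not_le.1 h)),
      by rw [Fin.le_pred_iff]; exact Fin.castSucc_lt_iff_succ_le.1 (not_le.1 h), by simp⟩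

/-- The monotone map of the ordinals obtained by doubling the elements `i` and `f i` that is induced
by a monotone map `f`. -/
def doubleMap (f : Fin (m + 1) →o Fin (n + 1)) (i : Fin (m + 1)) : Fin (m + 2) →o Fin (n + 2) where
  toFun j := if j ≤ i.castSucc then (f (i.predAbove j)).castSucc else (f (i.predAbove j)).succ
  monotone' j k hjk := by
    have h := f.monotone (Fin.predAbove_right_monotone i hjk)
    by_cases hk : k ≤ i.castSucc
    · simp only [if_pos hk, if_pos (hjk.trans hk)]
      exact Fin.castSucc_le_castSucc_iff.2 h
    · simp only [if_neg hk]
      split_ifs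
      · exact (Fin.castSucc_le_castSucc_iff.2 h).trans Fin.castSucc_lt_succ.le
      · exact Fin.succ_le_succ_iff.2 h

variable (f : Fin (m + 1) →o Fin (n + 1)) {i j : Fin (m + 1)}

theorem doubleMap_castSucc (h : j ≤ i) : doubleMap f i j.castSucc = (f j).castSucc :=
  (if_pos (Fin.castSucc_le_castSucc_iff.2 h)).trans (by rw [Fin.predAbove_castSucc_of_le _ _ h])

theorem doubleMap_succ (h : i ≤ j) : doubleMap f i j.succ = (f j).succ :=
  (if_neg (not_le.2 (Fin.castSucc_lt_succ_iff.2 h))).trans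
    (by rw [Fin.predAbove_succ_of_le _ _ h])

theorem predAbove_doubleMap (i : Fin (m + 1)) (j : Fin (m + 2)) :
    (f i).predAbove (doubleMap f i j) = f (i.predAbove j) := by
  rcases eq_castSucc_or_eq_succ i j with ⟨k, hk, rfl⟩ | ⟨k, hk, rfl⟩
  · rw [doubleMap_castSucc f hk, Fin.predAbove_castSucc_of_le _ _ (f.monotone hk),
      Fin.predAbove_castSucc_of_le _ _ hk]
  · rw [doubleMap_succ f hk, Fin.predAbove_succ_of_le _ _ (f.monotone hk),
      Fin.predAbove_succ_of_le _ _ hk]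

/-- The cut between the two copies is preserved, so the level function of the prism is natural. -/
theorem doubleMap_le_iff (i : Fin (m + 1)) (j : Fin (m + 2)) :
    doubleMap f i j ≤ (f i).castSucc ↔ j ≤ i.castSucc := by
  rcases eq_castSucc_or_eq_succ i j with ⟨k, hk, rfl⟩ | ⟨k, hk, rfl⟩
  · rw [doubleMap_castSucc f hk]
    exact iff_of_true (Fin.castSucc_le_castSucc_iff.2 (f.monotone hk))
      (Fin.castSucc_le_castSucc_iff.2 hk)
  · rw [doubleMap_succ f hk]
    exact iff_of_false (not_le.2 (Fin.castSucc_lt_succ_iff.2 (f.monotone hk)))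
      (not_le.2 (Fin.castSucc_lt_succ_iff.2 hk))

/-- The preimage of a set that contains `i` under the map that identifies the two copies of `i`. -/
def double (i : Fin (n + 1)) (F : Finset (Fin (n + 1))) : Finset (Fin (n + 2)) :=
  insert i.castSucc (F.image i.castSucc.succAbove)

variable {F : Finset (Fin (m + 1))}

theorem castSucc_notMem_image (i : Fin (m + 1)) (F : Finset (Fin (m + 1))) :
    i.castSucc ∉ F.image i.castSucc.succAbove := by
  simp [Fin.succAbove_ne]

theorem card_double (i : Fin (m + 1)) (F : Finset (Fin (m + 1))) :
    (double i F).card = F.card + 1 := by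
  rw [double, Finset.card_insert_of_notMem (castSucc_notMem_image i F),
    Finset.card_image_of_injective _ Fin.succAbove_right_injective]

theorem double_erase_castSucc (i : Fin (m + 1)) (F : Finset (Fin (m + 1))) :
    (double i F).erase i.castSucc = F.image i.castSucc.succAbove :=
  Finset.erase_insert (castSucc_notMem_image i F)

theorem image_succAbove_congr (h : i ∉ F) :
    F.image i.succ.succAbove = F.image i.castSucc.succAbove :=
  Finset.image_congr fun _ hj => succAbove_succ_eq fun e => h (e ▸ hj)

theorem double_eq (h : i ∈ F) :
    double i F = insert i.castSucc (insert i.succ ((F.erase i).image i.castSucc.succAbove)) := by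
  conv_lhs => rw [double, ← Finset.insert_erase h, Finset.image_insert, castSucc_succAbove_self]

theorem double_erase_succ (h : i ∈ F) :
    (double i F).erase i.succ = F.image i.succ.succAbove := by
  have h1 : i.succ ∉ (F.erase i).image i.castSucc.succAbove := fun h' => by
    obtain ⟨j, hj, e⟩ := Finset.mem_image.1 h'
    rw [← castSucc_succAbove_self] at e
    exact (Finset.mem_erase.1 hj).1 (Fin.succAbove_right_injective e)
  rw [double_eq h, Finset.insert_comm, Finset.erase_insert]
  · conv_rhs => rw [← Finset.insert_erase h, Finset.image_insert, succ_succAbove_self,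
      image_succAbove_congr (Finset.notMem_erase i F)]
  · rw [Finset.mem_insert, not_or]
    exact ⟨Fin.castSucc_lt_succ.ne', h1⟩

theorem double_erase_succAbove (i j : Fin (m + 1)) (F : Finset (Fin (m + 1))) :
    (double i F).erase (i.castSucc.succAbove j) = double i (F.erase j) := by
  rw [double, double, Finset.image_erase Fin.succAbove_right_injective,
    Finset.erase_insert_of_ne (Fin.succAbove_ne _ _).symm]

theorem castSucc_mem_double (hj : j ∈ F) (h : j ≤ i) : j.castSucc ∈ double i F := by
  rcases h.eq_or_lt with rfl | h
  · exact Finset.mem_insert_self _ _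
  · refine Finset.mem_insert_of_mem (Finset.mem_image.2 ⟨j, hj, ?_⟩)
    exact Fin.succAbove_of_castSucc_lt _ _ (Fin.castSucc_lt_castSucc_iff.2 h)

theorem succ_mem_double (hj : j ∈ F) (h : i ≤ j) : j.succ ∈ double i F :=
  Finset.mem_insert_of_mem (Finset.mem_image.2
    ⟨j, hj, Fin.succAbove_of_lt_succ _ _ (Fin.castSucc_lt_succ_iff.2 h)⟩)

theorem image_predAbove_double (h : i ∈ F) : (double i F).image i.predAbove = F := by
  rw [double, Finset.image_insert, Finset.image_image, Fin.predAbove_castSucc_self]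
  have : i.predAbove ∘ i.castSucc.succAbove = id :=
    funext fun j => Fin.predAbove_succAbove i j
  rw [this, Finset.image_id, Finset.insert_eq_of_mem h]

theorem sum_double {A : Type*} [AddCommMonoid A] (h : i ∈ F) (g : Fin (m + 2) → A) :
    ∑ j ∈ double i F, g j =
      g i.castSucc + (g i.succ + ∑ j ∈ F.erase i, g (i.castSucc.succAbove j)) := by
  rw [double, Finset.sum_insert (castSucc_notMem_image i F),
    Finset.sum_image fun _ _ _ _ e => Fin.succAbove_right_injective e, ← Finset.add_sum_erase F _ h,
    castSucc_succAbove_self]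

theorem card_filter_double (i : Fin (m + 1)) (F : Finset (Fin (m + 1))) (q : Fin (m + 2) → Prop)
    [DecidablePred q] :
    ((double i F).filter q).card =
      (F.filter fun j => q (i.castSucc.succAbove j)).card + if q i.castSucc then 1 else 0 := by
  rw [double, card_filter_insert _ _ _ (castSucc_notMem_image i F),
    card_filter_image F _ Fin.succAbove_right_injective.injOn q
      (fun j => q (i.castSucc.succAbove j)) fun _ _ => Iff.rfl]

theorem image_doubleMap_double (hf : Set.InjOn f F) (h : i ∈ F) :
    (double i F).image (doubleMap f i) = double (f i) (F.image f) := by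
  rw [double, double, Finset.image_insert, doubleMap_castSucc f le_rfl, Finset.image_image,
    Finset.image_image]
  congr 1
  refine Finset.image_congr fun j hj => ?_
  simp only [Function.comp]
  rcases lt_or_ge j i with hji | hji
  · rw [Fin.succAbove_of_castSucc_lt _ _ (Fin.castSucc_lt_castSucc_iff.2 hji),
      doubleMap_castSucc f hji.le, Fin.succAbove_of_castSucc_lt _ _
        (Fin.castSucc_lt_castSucc_iff.2
          (lt_of_le_of_ne (f.monotone hji.le) fun e => hji.ne (hf hj h e)))]
  · rw [Fin.succAbove_of_lt_succ _ _ (Fin.castSucc_lt_succ_iff.2 hji), doubleMap_succ f hji,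
      Fin.succAbove_of_lt_succ _ _ (Fin.castSucc_lt_succ_iff.2 (f.monotone hji))]

/-- Since `i` lies in both halves of the doubled set, injectivity on the two halves already detects
every collision of `f`; the converse is a count of elements. -/
theorem injOn_doubleMap_iff (h : i ∈ F) :
    Set.InjOn (doubleMap f i) (double i F : Set (Fin (m + 2))) ↔ Set.InjOn f F := by
  refine ⟨fun hd => ?_, fun hf => ?_⟩
  · suffices H : ∀ a ∈ F, ∀ b ∈ F, a < b → f a ≠ f b by
      intro a ha b hb e
      by_contra hne
      rcases lt_or_gt_of_ne hne with hab | hab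
      · exact H a ha b hb hab e
      · exact H b hb a ha hab e.symm
    intro a ha b hb hab e
    have key : ∀ x ∈ F, x ≤ i → ∀ y ∈ F, y ≤ i → f x = f y → x = y := fun x hx hxi y hy hyi e =>
      Fin.castSucc_injective _ (hd (castSucc_mem_double hx hxi) (castSucc_mem_double hy hyi)
        (by rw [doubleMap_castSucc f hxi, doubleMap_castSucc f hyi, e]))
    rcases le_total b i with hbi | hbi
    · exact hab.ne (key a ha (hab.le.trans hbi) b hb hbi e)
    rcases lt_or_ge a i with hai | hai
    -- If `a < i ≤ b` and `f a = f b`, monotonicity forces `f a = f i`, a collision inside the lower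
    -- half.
    · refine hai.ne (key a ha hai.le i h le_rfl (le_antisymm (f.monotone hai.le) ?_))
      rw [e]
      exact f.monotone hbi
    · exact hab.ne (Fin.succ_injective _ (hd (succ_mem_double ha hai) (succ_mem_double hb hbi)
        (by rw [doubleMap_succ f hai, doubleMap_succ f hbi, e])))
  · rw [← Finset.card_image_iff, image_doubleMap_double f hf h, card_double, card_double,
      Finset.card_image_of_injOn hf]

end Doubling

/-! ### The prism over a simplex -/

section Prism

variable {P : Type u} [PartialOrder P]

/-- The simplex `s₀ ≤ ⋯ ≤ sᵢ ≤ sᵢ ≤ ⋯ ≤ sₘ` obtained by doubling the vertex `i` of `σ`. -/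
abbrev prism (σ : Simp P) (i : Fin (σ.dom.len + 1)) : Simp P where
  dom := ⦋σ.dom.len + 1⦌
  chain := σ.chain.comp ⟨i.predAbove, Fin.predAbove_right_monotone i⟩

variable (σ : Simp P) (i : Fin (σ.dom.len + 1))

/-- The projection of the doubled simplex. -/
def prismProj : prism σ i ⟶ σ where
  map := SimplexCategory.σ i
  w _ := rfl

/-- The face of the doubled simplex that omits the first copy of the vertex `i`. -/
def prismUpper : σ ⟶ prism σ i where
  map := SimplexCategory.δ i.castSucc
  w j := congrArg σ.chain (Fin.predAbove_succAbove i j)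

/-- The face of the doubled simplex that omits the second copy of the vertex `i`. -/
def prismLower : σ ⟶ prism σ i where
  map := SimplexCategory.δ i.succ
  w j := congrArg σ.chain (predAbove_succ_succAbove i j)

theorem prismUpper_proj : prismUpper σ i ≫ prismProj σ i = 𝟙 σ :=
  Simp.Hom.ext (SimplexCategory.δ_comp_σ_self (i := i))

theorem prismLower_proj : prismLower σ i ≫ prismProj σ i = 𝟙 σ :=
  Simp.Hom.ext (SimplexCategory.δ_comp_σ_succ (i := i))

variable {σ} {σ' : Simp P} (θ : σ' ⟶ σ)

/-- The map of doubled simplices induced by `θ`. -/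
def prismMap (i : Fin (σ'.dom.len + 1)) : prism σ' i ⟶ prism σ (θ.map i) where
  map := SimplexCategory.Hom.mk (doubleMap (SimplexCategory.Hom.toOrderHom θ.map) i)
  w j := by
    refine (congrArg σ.chain
      (predAbove_doubleMap (SimplexCategory.Hom.toOrderHom θ.map) i j)).trans ?_
    exact θ.w _

theorem prismMap_proj (i : Fin (σ'.dom.len + 1)) :
    prismMap θ i ≫ prismProj σ (θ.map i) = prismProj σ' i ≫ θ := by
  refine Simp.Hom.ext (SimplexCategory.Hom.ext _ _ (OrderHom.ext _ _ (funext fun j => ?_)))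
  exact predAbove_doubleMap (SimplexCategory.Hom.toOrderHom θ.map) i j

variable {R : Type u} [CommRing R]

/-- Being a face is invariant under images, and the projection of the prism maps the doubled set
onto the original one. -/
theorem isFace_double {c : Cell σ} {i : Fin (σ.dom.len + 1)} (hi : i ∈ c.1) :
    IsFace (prism σ i) (double i c.1, c.2) ↔ IsFace σ c := by
  rw [← isFace_iff (prismProj σ i)]
  have : (double i c.1).image (prismProj σ i).map = c.1 := image_predAbove_double hi
  rw [this]

theorem dimAbove_le_double (c : Cell σ) (i : Fin (σ.dom.len + 1)) (s : P) :
    dimAbove σ c s ≤ dimAbove (prism σ i) (double i c.1, c.2) s := by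
  classical
  have h := card_filter_double i c.1 (fun j => s < (prism σ i).chain j)
  have e : (c.1.filter fun j => s < (prism σ i).chain (i.castSucc.succAbove j)) =
      c.1.filter fun j => s < σ.chain j := Finset.filter_congr fun j _ => by
    rw [show (prism σ i).chain (i.castSucc.succAbove j) = σ.chain j from
      congrArg σ.chain (Fin.predAbove_succAbove i j)]
  rw [e] at h
  simp only [dimAbove]
  exact Int.sub_le_sub_right (Int.ofNat_le.2 (le_of_le_of_eq (Nat.le_add_right _ _) h.symm)) _

/-- One vertex is added and the unconed strata stay the same, so no dimension can drop. This is what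
lets integration preserve allowability. -/
theorem perverseDegree_le_double (c : Cell σ) (i : Fin (σ.dom.len + 1)) (s : P) :
    perverseDegree σ c s ≤ perverseDegree (prism σ i) (double i c.1, c.2) s := by
  by_cases h : s ∈ c.2
  · simp only [perverseDegree, if_pos h]
    exact_mod_cast dimAbove_le_double c i s
  · simp only [perverseDegree, if_neg h, le_refl]

theorem vertexPos_double_castSucc (c : Cell σ) (i : Fin (σ.dom.len + 1)) :
    vertexPos (prism σ i) (double i c.1, c.2) i.castSucc = vertexPos σ c i := by
  have h := card_filter_double i c.1 (fun j => j < i.castSucc)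
  simp only [lt_irrefl, if_false, add_zero, Fin.succAbove_lt_iff_castSucc_lt,
    Fin.castSucc_lt_castSucc_iff] at h
  simp only [vertexPos]
  refine congrArg₂ (· + ·) h ?_
  rw [show (prism σ i).chain i.castSucc = σ.chain i from
    congrArg σ.chain (Fin.predAbove_castSucc_self i)]

/-- The extra vertex, the first copy of `i`, precedes the image of `j` exactly when `i ≤ j`; the
case `j = i` is the second copy. -/
theorem vertexPos_double_succAbove (c : Cell σ) (i j : Fin (σ.dom.len + 1)) :
    vertexPos (prism σ i) (double i c.1, c.2) (i.castSucc.succAbove j) =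
      vertexPos σ c j + if i ≤ j then 1 else 0 := by
  have h := card_filter_double i c.1 (fun k => k < i.castSucc.succAbove j)
  simp only [Fin.succAbove_lt_succAbove_iff, Fin.lt_succAbove_iff_le_castSucc,
    Fin.castSucc_le_castSucc_iff] at h
  simp only [vertexPos]
  rw [show (prism σ i).chain (i.castSucc.succAbove j) = σ.chain j from
    congrArg σ.chain (Fin.predAbove_succAbove i j)]
  exact (congrArg (· + _) h).trans (by omega)

theorem apexPos_double (c : Cell σ) (i : Fin (σ.dom.len + 1)) (s : P) [Decidable (σ.chain i ≤ s)] :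
    apexPos (prism σ i) (double i c.1, c.2) s =
      apexPos σ c s + if σ.chain i ≤ s then 1 else 0 := by
  classical
  have h := card_filter_double i c.1 (fun j => (prism σ i).chain j ≤ s)
  have e : (c.1.filter fun j => (prism σ i).chain (i.castSucc.succAbove j) ≤ s) =
      c.1.filter fun j => σ.chain j ≤ s := Finset.filter_congr fun j _ => by
    rw [show (prism σ i).chain (i.castSucc.succAbove j) = σ.chain j from
      congrArg σ.chain (Fin.predAbove_succAbove i j)]
  have e' : (prism σ i).chain i.castSucc = σ.chain i :=
    congrArg σ.chain (Fin.predAbove_castSucc_self i)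
  rw [e, e'] at h
  simp only [apexPos]
  refine (congrArg (· + _) h).trans ?_
  split_ifs <;> omega

end Prism

/-! ### Integration along the prism -/

section Integration

variable {P : Type u} [PartialOrder P] {R : Type u} [CommRing R] {σ : Simp P}

variable (R σ) in
/-- The integral, along the interval, of a family of cochains on the top simplices of the prism
over `σ`. -/
noncomputable def prismInt :
    (∀ i : Fin (σ.dom.len + 1), Cell (prism σ i) → R) →ₗ[R] (Cell σ → R) where
  toFun α c := ∑ i ∈ c.1, (-1) ^ vertexPos σ c i * α i (double i c.1, c.2)
  map_add' α β := by
    ext c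
    simp only [Pi.add_apply, mul_add, Finset.sum_add_distrib]
  map_smul' a α := by
    ext c
    simp only [Pi.smul_apply, smul_eq_mul, Finset.mul_sum, RingHom.id_apply]
    exact Finset.sum_congr rfl fun _ _ => mul_left_comm _ _ _

theorem prismInt_apply (α : ∀ i : Fin (σ.dom.len + 1), Cell (prism σ i) → R) (c : Cell σ) :
    prismInt R σ α c = ∑ i ∈ c.1, (-1) ^ vertexPos σ c i * α i (double i c.1, c.2) := rfl

theorem prismInt_ne_zero {α : ∀ i : Fin (σ.dom.len + 1), Cell (prism σ i) → R} {c : Cell σ}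
    (h : prismInt R σ α c ≠ 0) : ∃ i ∈ c.1, α i (double i c.1, c.2) ≠ 0 := by
  obtain ⟨i, hi, hne⟩ := Finset.exists_ne_zero_of_sum_ne_zero h
  exact ⟨i, hi, right_ne_zero_of_mul hne⟩

theorem prismInt_vanish {α : ∀ i : Fin (σ.dom.len + 1), Cell (prism σ i) → R}
    (hα : ∀ i c, ¬ IsFace (prism σ i) c → α i c = 0) (c : Cell σ) (hc : ¬ IsFace σ c) :
    prismInt R σ α c = 0 := by
  by_contra hne
  obtain ⟨i, hi, h⟩ := prismInt_ne_zero hne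
  exact h (hα i _ fun h' => hc ((isFace_double hi).1 h'))

theorem isCochain_prismInt {k : ℕ} {α : ∀ i : Fin (σ.dom.len + 1), Cell (prism σ i) → R}
    (hα : ∀ i, IsCochain (prism σ i) (k + 1) (α i)) : IsCochain σ k (prismInt R σ α) := by
  intro c hc
  obtain ⟨i, hi, h⟩ := prismInt_ne_zero hc
  obtain ⟨h1, h2⟩ := hα i _ h
  refine ⟨(isFace_double hi).1 h1, ?_⟩
  have h3 := card_double i c.1
  simp only at h2
  omega

/-- A cell of dimension 0 has as many vertices as unconed strata, one in each; a doubled cell has a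
vertex to spare. This supplies the homotopy in degree 0, where one term is absent. -/
theorem prismInt_eq_zero {α : ∀ i : Fin (σ.dom.len + 1), Cell (prism σ i) → R}
    (hα : ∀ i, IsCochain (prism σ i) 0 (α i)) : prismInt R σ α = 0 := by
  classical
  ext c
  by_contra hc
  obtain ⟨i, hi, h⟩ := prismInt_ne_zero hc
  obtain ⟨h1, h2⟩ := hα i _ h
  have h3 : c.2 ⊆ c.1.image σ.chain := fun s hs => by
    obtain ⟨j, hj, e⟩ := ((isFace_double hi).1 h1).2.2 s hs
    exact Finset.mem_image.2 ⟨j, hj, e⟩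
  have h4 := (Finset.card_le_card h3).trans Finset.card_image_le
  have h5 := card_double i c.1
  simp only at h2
  omega

theorem allowable_prismInt (p : Perversity P)
    {α : ∀ i : Fin (σ.dom.len + 1), Cell (prism σ i) → R}
    (hα : ∀ i, Allowable p (prism σ i) (α i)) : Allowable p σ (prismInt R σ α) := by
  intro s c hc
  obtain ⟨i, _, h⟩ := prismInt_ne_zero hc
  exact (perverseDegree_le_double c i s).trans (hα i s _ h)

/-- The homotopy formula. -/
theorem delta_prismInt {α : ∀ i : Fin (σ.dom.len + 1), Cell (prism σ i) → R}
    (hα : ∀ i c, ¬ IsFace (prism σ i) c → α i c = 0) {β : ℕ → Cell σ → R}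
    (hβ : ∀ a c, ¬ IsFace σ c → β a c = 0)
    (hu : ∀ i : Fin (σ.dom.len + 1), pullback R (prismUpper σ i) (α i) = β i)
    (hl : ∀ i : Fin (σ.dom.len + 1), pullback R (prismLower σ i) (α i) = β (i + 1)) :
    delta R σ (prismInt R σ α) + prismInt R σ (fun i => delta R (prism σ i) (α i)) =
      β 0 - β (σ.dom.len + 1) := by
  classical
  have hu' : ∀ (i : Fin (σ.dom.len + 1)) (c : Cell σ),
      α i (c.1.image i.castSucc.succAbove, c.2) = β i c := fun i c => by
    rw [← hu]
    exact (pullback_apply (prismUpper σ i) _ c Fin.succAbove_right_injective.injOn).symm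
  have hl' : ∀ (i : Fin (σ.dom.len + 1)) (c : Cell σ),
      α i (c.1.image i.succ.succAbove, c.2) = β (i + 1) c := fun i c => by
    rw [← hl]
    exact (pullback_apply (prismLower σ i) _ c Fin.succAbove_right_injective.injOn).symm
  ext c
  rw [Pi.add_apply, Pi.sub_apply]
  by_cases hc : IsFace σ c
  swap
  · rw [delta_vanish σ _ c hc, prismInt_vanish (fun i c h => delta_vanish _ _ c h) c hc, hβ _ c hc,
      hβ _ c hc, add_zero, sub_zero]
  -- Telescoping runs over all vertices of `σ`. If `i` is not a vertex of `c`, the consecutive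
  -- sections agree on `c` and the term vanishes.
  have htel : ∑ i ∈ c.1, (β i c - β (i + 1) c) = β 0 c - β (σ.dom.len + 1) c := by
    rw [← Finset.sum_range_sub' (fun a => β a c),
      Finset.sum_range (fun a => β a c - β (a + 1) c)]
    refine Finset.sum_subset (Finset.subset_univ _) fun i _ hi => ?_
    rw [← hu', ← hl', image_succAbove_congr hi, sub_self]
  -- Deleting the two copies of `i` yields two consecutive sections with opposite signs. The
  -- remaining terms delete another vertex or an apex and must cancel against `δ` of the integral.
  have hmain : ∀ i ∈ c.1, (-1) ^ vertexPos σ c i *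
      delta R (prism σ i) (α i) (double i c.1, c.2) = (β i c - β (i + 1) c) +
        (∑ j ∈ c.1.erase i, (-1) ^ (vertexPos σ c i + vertexPos σ c j + if i ≤ j then 1 else 0) *
          α i (double i (c.1.erase j), c.2)) +
        ∑ s ∈ c.1.image σ.chain \ c.2,
          (-1) ^ (vertexPos σ c i + apexPos σ c s + if σ.chain i ≤ s then 1 else 0) *
            α i (double i c.1, insert s c.2) := by
    intro i hi
    have hf := (isFace_double hi).2 hc
    have himg : (double i c.1).image (prism σ i).chain = c.1.image σ.chain := by
      conv_rhs => rw [← image_predAbove_double hi, Finset.image_image]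
      rfl
    rw [delta_apply_of_vanish (prism σ i) (hα i) _ hf.1 hf.2.1, mul_add]
    simp only [himg]
    congr 1
    · refine (congrArg ((-1) ^ vertexPos σ c i * ·) (sum_double hi _)).trans ?_
      rw [vertexPos_double_castSucc, double_erase_castSucc, hu']
      have e : vertexPos (prism σ i) (double i c.1, c.2) i.succ = vertexPos σ c i + 1 := by
        have := vertexPos_double_succAbove c i i
        rwa [castSucc_succAbove_self, if_pos le_rfl] at this
      rw [e, double_erase_succ hi, hl', mul_add, mul_add, ← add_assoc, Finset.mul_sum]
      congr 1
      · rw [← mul_assoc, ← mul_assoc, ← pow_add, ← pow_add,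
          show vertexPos σ c i + (vertexPos σ c i + 1) = 2 * vertexPos σ c i + 1 by ring,
          ← two_mul, pow_succ, pow_mul]
        simp [sub_eq_add_neg]
      · refine Finset.sum_congr rfl fun j _ => ?_
        rw [vertexPos_double_succAbove, double_erase_succAbove, ← mul_assoc, ← pow_add,
            add_assoc (vertexPos σ c i)]
    · rw [Finset.mul_sum]
      refine Finset.sum_congr rfl fun s _ => ?_
      rw [apexPos_double, ← mul_assoc, ← pow_add, add_assoc (vertexPos σ c i)]
  rw [prismInt_apply, Finset.sum_congr rfl hmain, Finset.sum_add_distrib, Finset.sum_add_distrib,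
    htel, delta_apply_of_vanish σ (prismInt_vanish hα) c hc.1 hc.2.1]
  simp only [prismInt_apply, Finset.mul_sum]
  suffices h : (∑ j ∈ c.1, ∑ i ∈ c.1.erase j,
        (-1) ^ vertexPos σ c j * ((-1) ^ vertexPos σ (c.1.erase j, c.2) i *
          α i (double i (c.1.erase j), c.2))) +
      (∑ i ∈ c.1, ∑ j ∈ c.1.erase i,
        (-1) ^ (vertexPos σ c i + vertexPos σ c j + if i ≤ j then 1 else 0) *
          α i (double i (c.1.erase j), c.2)) = 0 ∧
      (∑ s ∈ c.1.image σ.chain \ c.2, ∑ i ∈ c.1,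
        (-1) ^ apexPos σ c s * ((-1) ^ vertexPos σ (c.1, insert s c.2) i *
          α i (double i c.1, insert s c.2))) +
      (∑ i ∈ c.1, ∑ s ∈ c.1.image σ.chain \ c.2,
          (-1) ^ (vertexPos σ c i + apexPos σ c s + if σ.chain i ≤ s then 1 else 0) *
            α i (double i c.1, insert s c.2)) = 0 by
    linear_combination h.1 + h.2
  constructor
  -- For `i ≠ j` exactly one of `j < i` and `i ≤ j` holds, so the two signs are opposite.
  · rw [Finset.sum_comm' (t' := c.1) (s' := fun j => c.1.erase j) (s := c.1)
      (t := fun j => c.1.erase j) (by simp only [Finset.mem_erase]; tauto),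
      ← Finset.sum_add_distrib]
    refine Finset.sum_eq_zero fun i hi => ?_
    rw [← Finset.sum_add_distrib]
    refine Finset.sum_eq_zero fun j hj => ?_
    obtain ⟨hji, hj⟩ := Finset.mem_erase.1 hj
    have e : vertexPos σ c i = vertexPos σ (c.1.erase j, c.2) i + if j < i then 1 else 0 := by
      simp only [vertexPos]
      rw [card_filter_erase c.1 (fun k => k < i) j hj]
      omega
    rw [← mul_assoc, ← pow_add]
    refine sign_cancel _ _ _ (Or.inr ?_)
    rw [e]
    rcases lt_or_gt_of_ne hji with h | h
    · rw [if_pos h, if_neg (not_le.2 h)]; omega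
    · rw [if_neg h.not_gt, if_pos h.le]; omega
  -- The stratum `s` is met by `c`, hence comparable with that of `i`. Exactly one of `s < σ.chain
  -- i` and `σ.chain i ≤ s` holds, which again gives opposite signs.
  · rw [Finset.sum_comm, ← Finset.sum_add_distrib]
    refine Finset.sum_eq_zero fun i hi => ?_
    rw [← Finset.sum_add_distrib]
    refine Finset.sum_eq_zero fun s hs => ?_
    obtain ⟨hs1, hsZ⟩ := Finset.mem_sdiff.1 hs
    obtain ⟨j, _, ej⟩ := Finset.mem_image.1 hs1
    have hcmp : s < σ.chain i ↔ ¬ σ.chain i ≤ s := by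
      subst ej
      refine ⟨not_le_of_gt, fun h => ?_⟩
      rcases le_total i j with hij | hij
      · exact absurd (σ.chain.monotone hij) h
      · exact lt_of_le_of_ne (σ.chain.monotone hij) fun e => h e.ge
    have e : vertexPos σ (c.1, insert s c.2) i =
        vertexPos σ c i + if s < σ.chain i then 1 else 0 := by
      simp only [vertexPos]
      rw [card_filter_insert _ _ s hsZ]
      omega
    rw [← mul_assoc, ← pow_add, e]
    refine sign_cancel _ _ _ ?_
    by_cases h : σ.chain i ≤ s
    · rw [if_pos h, if_neg fun h' => hcmp.1 h' h]; right; omega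
    · rw [if_neg h, if_pos (hcmp.2 h)]; left; omega

/-- Allowability of `δ ∫ α` is read off the homotopy formula: it equals a difference of two sections
minus `∫ δ α`, and each term is allowable. -/
theorem prismInt_mem (p : Perversity P) {k : ℕ}
    {α : ∀ i : Fin (σ.dom.len + 1), Cell (prism σ i) → R}
    (hα : ∀ i, α i ∈ intersectionCochains R p (prism σ i) (k + 1)) {β : ℕ → Cell σ → R}
    (hβ : ∀ a, β a ∈ intersectionCochains R p σ (k + 1))
    (hu : ∀ i : Fin (σ.dom.len + 1), pullback R (prismUpper σ i) (α i) = β i)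
    (hl : ∀ i : Fin (σ.dom.len + 1), pullback R (prismLower σ i) (α i) = β (i + 1)) :
    prismInt R σ α ∈ intersectionCochains R p σ k := by
  refine ⟨isCochain_prismInt fun i => (hα i).1, allowable_prismInt p fun i => (hα i).2.1, ?_⟩
  have h := delta_prismInt (fun i => (hα i).1.vanish) (fun a => (hβ a).1.vanish) hu hl
  intro s c hc
  rw [eq_sub_of_add_eq h] at hc
  by_cases h1 : (β 0 - β (σ.dom.len + 1)) c = 0
  · rw [Pi.sub_apply, h1, zero_sub] at hc
    exact allowable_prismInt p (fun i => (hα i).2.2) s c (neg_ne_zero.1 hc)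
  · exact ((intersectionCochains R p σ (k + 1)).sub_mem (hβ 0) (hβ _)).2.1 s c h1

/-- If `θ` is injective on the cell, doubling commutes with taking images and positions are
unchanged. Otherwise it is not injective on any doubled cell either, and both sides vanish. -/
theorem pullback_prismInt {σ' : Simp P} (θ : σ' ⟶ σ)
    (α : ∀ i : Fin (σ.dom.len + 1), Cell (prism σ i) → R) :
    pullback R θ (prismInt R σ α) =
      prismInt R σ' fun i => pullback R (prismMap θ i) (α (θ.map i)) := by
  ext c
  let f := SimplexCategory.Hom.toOrderHom θ.map
  by_cases hi : Set.InjOn θ.map c.1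
  · rw [pullback_apply θ _ c hi, prismInt_apply, prismInt_apply]
    refine (Finset.sum_image hi).trans (Finset.sum_congr rfl fun i hic => ?_)
    have e : vertexPos σ (c.1.image θ.map, c.2) (θ.map i) = vertexPos σ' c i := by
      simp only [vertexPos]
      rw [card_filter_image c.1 θ.map hi (fun j => j < θ.map i) (fun j => j < i)
        fun j hj => lt_iff_of_injOn θ hi hic hj, chain_map θ i]
    have hd : Set.InjOn (prismMap θ i).map (double i c.1 : Set (Fin (σ'.dom.len + 2))) :=
      (injOn_doubleMap_iff f hic).2 hi
    have himg : (double i c.1).image (prismMap θ i).map = double (θ.map i) (c.1.image θ.map) :=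
      image_doubleMap_double f hi hic
    rw [e, pullback_apply (prismMap θ i) _ (double i c.1, c.2) hd]
    simp only [himg]
  · rw [pullback_apply_zero θ _ c hi, prismInt_apply]
    refine (Finset.sum_eq_zero fun i hic => ?_).symm
    rw [pullback_apply_zero (prismMap θ i) _ (double i c.1, c.2)
      fun h => hi ((injOn_doubleMap_iff f hic).1 h), mul_zero]

end Integration

/-! ### Blown up cochains over a full subcategory of the category of simplices -/

section Assembly

variable {P : Type u} [PartialOrder P] {R : Type u} [CommRing R] (p : Perversity P)
  {C : Type u} [Category.{v} C] (I : C ⥤ Simp P)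

theorem isExtendable_intersectionFunctor :
    IsExtendable (I ⋙ Simp.shape P) (I.op ⋙ intersectionFunctor R p) := by
  intro L k
  let ext (σ : Simp P) (χ : Fin (σ.dom.len + 1) →o Fin 2) :
      intersectionCochains R p σ k →ₗ[R] intersectionCochains R p σ k :=
    (extendByZero R χ).restrict fun _ h => extendByZero_mem p χ h
  refine ⟨ModuleCat.ofHom
    { toFun := fun ω => ⟨fun σ a =>
        ext (I.obj σ.unop) (SSet.stdSimplex.asOrderHom a.2) (ω.1 σ a.1), fun σ τ θ a => ?_⟩
      map_add' := fun ω η => Subtype.ext <| funext fun σ => funext fun a => map_add (ext _ _) _ _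
      map_smul' := fun r ω => Subtype.ext <| funext fun σ => funext fun a =>
        map_smul (ext _ _) _ _ }, ?_, ?_⟩
  · refine Subtype.ext ?_
    have h := congrArg Subtype.val (ω.2 θ a.1)
    refine (congrArg (extendByZero R _) h).trans ?_
    exact (pullback_extendByZero (I.map θ.unop) _ _).symm
  · ext ω
    refine Subtype.ext <| funext fun σ => funext fun x => Subtype.ext ?_
    exact extendByZero_zero (ω.1 σ x).2.1
  · ext ω
    refine Subtype.ext <| funext fun σ => funext fun x => Subtype.ext ?_
    exact extendByZero_one (ω.1 σ x).1

theorem intersectionComplex_d_apply (σ : Simp P) (k : ℕ) (ω : intersectionCochains R p σ k) :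
    (show intersectionCochains R p σ (k + 1) from
      (intersectionComplex R p σ).d k (k + 1) ω).1 = delta R σ ω.1 := by
  simp only [intersectionComplex, dif_pos]
  rfl

/-- The simplex of `Δ[1]` that has level `0` on the first `a` vertices and level `1` on the
others. -/
def stepSimplex (n : SimplexCategory) (a : ℕ) : (Δ[1] : SSet.{u}).obj (op n) :=
  SSet.stdSimplex.objMk
    { toFun := fun j => if j.1 < a then 0 else 1
      monotone' := fun j k hjk => by
        dsimp only
        split_ifs with h1 h2
        · exact le_rfl
        · exact Fin.zero_le _
        · exact absurd (lt_of_le_of_lt (Fin.le_def.1 hjk) (by assumption)) h1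
        · exact le_rfl }

theorem map_stepSimplex {m n : SimplexCategory} (g : m ⟶ n) {a b : ℕ}
    (h : ∀ j : Fin (m.len + 1), (g j).1 < a ↔ j.1 < b) :
    (Δ[1] : SSet.{u}).map g.op (stepSimplex n a) = stepSimplex m b := by
  refine SSet.stdSimplex.ext (d := m.len) _ _ fun j => ?_
  exact if_congr (h j) rfl rfl

theorem stepSimplex_zero (n : SimplexCategory) :
    stepSimplex.{u} n 0 = SSet.stdSimplex.const 1 1 (op n) :=
  SSet.stdSimplex.ext (d := n.len) (stepSimplex n 0) _ fun j =>
    (if_neg (Nat.not_lt_zero j.1) : (if j.1 < 0 then 0 else 1 : Fin 2) = 1)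

theorem stepSimplex_last (n : SimplexCategory) :
    stepSimplex.{u} n (n.len + 1) = SSet.stdSimplex.const 1 0 (op n) :=
  SSet.stdSimplex.ext (d := n.len) (stepSimplex n (n.len + 1)) _ fun j => if_pos j.2

variable [I.Full] [I.Faithful] {L : Cᵒᵖ ⥤ Type u} {k : ℕ}

-- After pullback to `τ`, the value of a cochain depends only on the composite map to `I.obj c` and
-- on the levels. Both sides are compared with the value at an object of `C` isomorphic to `τ`,
-- using fullness to lift the maps and faithfulness to identify them.
variable {p I} in
theorem pullback_eq_of_factor
    (ω : naturalFamilies (I.op ⋙ intersectionFunctor R p)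
      (tensor (I ⋙ Simp.shape P) L (Δ[1] : SSet.{u})) k)
    {c c₁ c₂ : C} (x : L.obj (op c)) (f₁ : c₁ ⟶ c) (f₂ : c₂ ⟶ c)
    (χ₁ : (Δ[1] : SSet.{u}).obj (op (I.obj c₁).dom))
    (χ₂ : (Δ[1] : SSet.{u}).obj (op (I.obj c₂).dom)) {τ : Simp P} (hτ : I.essImage τ)
    (g₁ : τ ⟶ I.obj c₁) (g₂ : τ ⟶ I.obj c₂) (hf : g₁ ≫ I.map f₁ = g₂ ≫ I.map f₂)
    (hχ : (Δ[1] : SSet.{u}).map g₁.map.op χ₁ = (Δ[1] : SSet.{u}).map g₂.map.op χ₂) :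
    pullback R g₁ (ω.1 (op c₁) (L.map f₁.op x, χ₁)).1 =
      pullback R g₂ (ω.1 (op c₂) (L.map f₂.op x, χ₂)).1 := by
  obtain ⟨c₀, ⟨e⟩⟩ := hτ
  have key : ∀ {c' : C} (f : c' ⟶ c) (χ : (Δ[1] : SSet.{u}).obj (op (I.obj c').dom))
      (g : τ ⟶ I.obj c'),
      pullback R g (ω.1 (op c') (L.map f.op x, χ)).1 = pullback R e.inv
        (ω.1 (op c₀) (L.map (I.preimage (e.hom ≫ g ≫ I.map f)).op x,
          (Δ[1] : SSet.{u}).map e.hom.map.op ((Δ[1] : SSet.{u}).map g.map.op χ))).1 := by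
    intro c' f χ g
    obtain ⟨m, hm⟩ := I.map_surjective (e.hom ≫ g)
    have h1 : I.preimage (e.hom ≫ g ≫ I.map f) = m ≫ f := I.map_injective (by
      rw [I.map_preimage, I.map_comp, hm, Category.assoc])
    have h2 : (Δ[1] : SSet.{u}).map e.hom.map.op ((Δ[1] : SSet.{u}).map g.map.op χ) =
        (Δ[1] : SSet.{u}).map (I.map m).map.op χ := by
      rw [hm]
      exact (Functor.map_comp_apply (Δ[1] : SSet.{u}) g.map.op e.hom.map.op χ).symm
    rw [h1, h2, op_comp, L.map_comp_apply]
    have h3 := congrArg Subtype.val (ω.2 m.op (L.map f.op x, χ))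
    refine Eq.trans ?_ (congrArg (pullback R e.inv) h3.symm)
    refine Eq.trans ?_ (pullback_comp e.inv (I.map m) _)
    rw [hm, Iso.inv_hom_id_assoc]
    rfl
  refine (key f₁ χ₁ g₁).trans (Eq.trans ?_ (key f₂ χ₂ g₂).symm)
  rw [hf, hχ]

/-! ### Values of a cochain on prisms and on horizontal sections. -/

variable (hI : ∀ (c : C) (i : Fin ((I.obj c).dom.len + 1)), I.essImage (prism (I.obj c) i))

/-- The values of a cochain on `L ⊗ Δ[1]` on the top simplices of the prism over a simplex of
`L`. -/
noncomputable def prismFamily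
    (ω : naturalFamilies (I.op ⋙ intersectionFunctor R p)
      (tensor (I ⋙ Simp.shape P) L (Δ[1] : SSet.{u})) k) (c : C) (x : L.obj (op c))
    (i : Fin ((I.obj c).dom.len + 1)) : Cell (prism (I.obj c) i) → R :=
  pullback R (hI c i).getIso.inv (ω.1 (op (hI c i).witness)
    (L.map (I.preimage ((hI c i).getIso.hom ≫ prismProj (I.obj c) i)).op x,
      (Δ[1] : SSet.{u}).map (hI c i).getIso.hom.map.op (stepSimplex _ (i.1 + 1)))).1

variable {p I}

omit [I.Faithful] in
theorem prismFamily_mem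
    (ω : naturalFamilies (I.op ⋙ intersectionFunctor R p)
      (tensor (I ⋙ Simp.shape P) L (Δ[1] : SSet.{u})) k) (c : C) (x : L.obj (op c))
    (i : Fin ((I.obj c).dom.len + 1)) :
    prismFamily p I hI ω c x i ∈ intersectionCochains R p (prism (I.obj c) i) k :=
  pullback_mem p _ (Subtype.prop _)

/-- Frees later arguments from the chosen object of `C` that represents the prism: its isomorphism
cancels, and only the projection and the levels matter. -/
theorem pullback_prismFamily
    (ω : naturalFamilies (I.op ⋙ intersectionFunctor R p)
      (tensor (I ⋙ Simp.shape P) L (Δ[1] : SSet.{u})) k) {c c' : C} (x : L.obj (op c))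
    (i : Fin ((I.obj c).dom.len + 1)) (f : c' ⟶ c) (χ : (Δ[1] : SSet.{u}).obj (op (I.obj c').dom))
    {τ : Simp P} (hτ : I.essImage τ) (h : τ ⟶ prism (I.obj c) i) (g : τ ⟶ I.obj c')
    (hf : h ≫ prismProj (I.obj c) i = g ≫ I.map f)
    (hχ : (Δ[1] : SSet.{u}).map h.map.op (stepSimplex _ (i.1 + 1)) =
      (Δ[1] : SSet.{u}).map g.map.op χ) :
    pullback R h (prismFamily p I hI ω c x i) =
      pullback R g (ω.1 (op c') (L.map f.op x, χ)).1 := by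
  refine (pullback_comp h (hI c i).getIso.inv _).symm.trans ?_
  refine pullback_eq_of_factor ω x _ f _ χ hτ _ g ?_ ?_
  · rw [I.map_preimage, Category.assoc, Iso.inv_hom_id_assoc, hf]
  · rw [← hχ]
    refine (Functor.map_comp_apply (Δ[1] : SSet.{u}) _ _ _).symm.trans ?_
    have e : (h ≫ (hI c i).getIso.inv).map ≫ (hI c i).getIso.hom.map = h.map :=
      congrArg Simp.Hom.map (show (h ≫ (hI c i).getIso.inv) ≫ (hI c i).getIso.hom = h by
        rw [Category.assoc, Iso.inv_hom_id, Category.comp_id])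
    rw [← op_comp, e]

/-- The values of a cochain on `L ⊗ Δ[1]` on the horizontal sections of the prism over a simplex
of `L`. -/
def sectionFamily
    (ω : naturalFamilies (I.op ⋙ intersectionFunctor R p)
      (tensor (I ⋙ Simp.shape P) L (Δ[1] : SSet.{u})) k) (c : C) (x : L.obj (op c)) (a : ℕ) :
    Cell (I.obj c) → R :=
  (ω.1 (op c) (x, stepSimplex _ a)).1

omit [I.Full] [I.Faithful] in
theorem sectionFamily_mem
    (ω : naturalFamilies (I.op ⋙ intersectionFunctor R p)
      (tensor (I ⋙ Simp.shape P) L (Δ[1] : SSet.{u})) k) (c : C) (x : L.obj (op c)) (a : ℕ) :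
    sectionFamily ω c x a ∈ intersectionCochains R p (I.obj c) k :=
  Subtype.prop (ω.1 (op c) (x, stepSimplex _ a))

theorem pullback_prismFamily_section
    (ω : naturalFamilies (I.op ⋙ intersectionFunctor R p)
      (tensor (I ⋙ Simp.shape P) L (Δ[1] : SSet.{u})) k) {c : C} (x : L.obj (op c))
    (i : Fin ((I.obj c).dom.len + 1)) (h : I.obj c ⟶ prism (I.obj c) i) (a : ℕ)
    (hf : h ≫ prismProj (I.obj c) i = 𝟙 _)
    (hχ : ∀ j : Fin ((I.obj c).dom.len + 1), (h.map j).1 < i.1 + 1 ↔ j.1 < a) :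
    pullback R h (prismFamily p I hI ω c x i) = sectionFamily ω c x a := by
  refine (pullback_prismFamily hI ω x i (𝟙 c) (stepSimplex _ a) ⟨c, ⟨Iso.refl _⟩⟩ h (𝟙 _) ?_ ?_).trans
    ?_
  · rw [hf, I.map_id, Category.id_comp]
  · rw [map_stepSimplex h.map hχ]
    exact (map_stepSimplex (𝟙 _) fun j => Iff.rfl).symm
  · rw [op_id, L.map_id]
    exact pullback_id _

theorem prismUpper_prismFamily
    (ω : naturalFamilies (I.op ⋙ intersectionFunctor R p)
      (tensor (I ⋙ Simp.shape P) L (Δ[1] : SSet.{u})) k) (c : C) (x : L.obj (op c))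
    (i : Fin ((I.obj c).dom.len + 1)) :
    pullback R (prismUpper (I.obj c) i) (prismFamily p I hI ω c x i) =
      sectionFamily ω c x i :=
  pullback_prismFamily_section hI ω x i _ _ (prismUpper_proj _ i) fun j =>
    castSucc_succAbove_val_lt_iff i j

theorem prismLower_prismFamily
    (ω : naturalFamilies (I.op ⋙ intersectionFunctor R p)
      (tensor (I ⋙ Simp.shape P) L (Δ[1] : SSet.{u})) k) (c : C) (x : L.obj (op c))
    (i : Fin ((I.obj c).dom.len + 1)) :
    pullback R (prismLower (I.obj c) i) (prismFamily p I hI ω c x i) =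
      sectionFamily ω c x (i + 1) :=
  pullback_prismFamily_section hI ω x i _ _ (prismLower_proj _ i) fun j =>
    succ_succAbove_val_lt_iff i j

/-- Both sides are the value on one simplex of `L ⊗ Δ[1]`, because `prismMap` commutes with the
projections and respects the cut between the copies. -/
theorem prismFamily_map
    (ω : naturalFamilies (I.op ⋙ intersectionFunctor R p)
      (tensor (I ⋙ Simp.shape P) L (Δ[1] : SSet.{u})) k) {c c' : C} (θ : c' ⟶ c)
    (x : L.obj (op c)) (i : Fin ((I.obj c').dom.len + 1)) :
    prismFamily p I hI ω c' (L.map θ.op x) i =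
      pullback R (prismMap (I.map θ) i) (prismFamily p I hI ω c x ((I.map θ).map i)) := by
  have h := pullback_prismFamily hI ω x ((I.map θ).map i)
    (I.preimage ((hI c' i).getIso.hom ≫ prismProj (I.obj c') i) ≫ θ)
    ((Δ[1] : SSet.{u}).map (hI c' i).getIso.hom.map.op (stepSimplex _ (i.1 + 1)))
    (hI c' i) (prismMap (I.map θ) i) (hI c' i).getIso.inv ?_ ?_
  · rw [h, op_comp, L.map_comp_apply]
    rfl
  · rw [I.map_comp, I.map_preimage, Category.assoc, Iso.inv_hom_id_assoc, prismMap_proj]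
  · refine Eq.trans ?_ (Functor.map_comp_apply (Δ[1] : SSet.{u}) _ _ _)
    have e : (hI c' i).getIso.inv.map ≫ (hI c' i).getIso.hom.map = 𝟙 _ :=
      congrArg Simp.Hom.map (hI c' i).getIso.inv_hom_id
    rw [← op_comp, e, map_stepSimplex (prismMap (I.map θ) i).map (b := i.1 + 1)]
    · exact (map_stepSimplex (𝟙 _) fun j => Iff.rfl).symm
    · intro j
      have := doubleMap_le_iff (SimplexCategory.Hom.toOrderHom (I.map θ).map) i j
      rw [Fin.le_def, Fin.le_def, ← Nat.lt_succ_iff, ← Nat.lt_succ_iff] at this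
      exact this

/-! ### Integration on presheaves and the resulting cochain homotopy. -/

variable (L) in
/-- Integration along the interval, `Hom(L ⊗ Δ[1], Ñᵏ⁺¹) → Hom(L, Ñᵏ)`. -/
noncomputable def integrate (k : ℕ) :
    (cochains (I.op ⋙ intersectionFunctor R p)
      (tensor (I ⋙ Simp.shape P) L (Δ[1] : SSet.{u}))).X (k + 1) ⟶
    (cochains (I.op ⋙ intersectionFunctor R p) L).X k :=
  ModuleCat.ofHom
    { toFun := fun ω => ⟨fun σ x =>
          ⟨prismInt R (I.obj σ.unop) (prismFamily p I hI ω σ.unop x),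
            prismInt_mem p (prismFamily_mem hI ω σ.unop x) (sectionFamily_mem ω σ.unop x)
              (prismUpper_prismFamily hI ω σ.unop x) (prismLower_prismFamily hI ω σ.unop x)⟩,
        fun σ τ θ x => by
          refine Subtype.ext ?_
          refine Eq.trans ?_ (pullback_prismInt (I.map θ.unop) _).symm
          refine congrArg (prismInt R (I.obj τ.unop)) (funext fun i => ?_)
          exact prismFamily_map hI ω θ.unop x i⟩
      map_add' := fun ω η => Subtype.ext <| funext fun σ => funext fun x => Subtype.ext <| by
        refine Eq.trans ?_ (map_add (prismInt R (I.obj σ.unop)) _ _)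
        exact congrArg (prismInt R (I.obj σ.unop)) (funext fun i => map_add (pullback R _) _ _)
      map_smul' := fun r ω => Subtype.ext <| funext fun σ => funext fun x => Subtype.ext <| by
        refine Eq.trans ?_ (map_smul (prismInt R (I.obj σ.unop)) r _)
        exact congrArg (prismInt R (I.obj σ.unop)) (funext fun i => map_smul (pullback R _) r _) }

omit [I.Faithful] in
theorem prismFamily_d
    (ω : naturalFamilies (I.op ⋙ intersectionFunctor R p)
      (tensor (I ⋙ Simp.shape P) L (Δ[1] : SSet.{u})) k) (c : C) (x : L.obj (op c))
    (i : Fin ((I.obj c).dom.len + 1)) :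
    prismFamily p I hI ((cochains (I.op ⋙ intersectionFunctor R p)
      (tensor (I ⋙ Simp.shape P) L (Δ[1] : SSet.{u}))).d k (k + 1) ω) c x i =
        delta R _ (prismFamily p I hI ω c x i) := by
  have hω : ∀ (c' : C) (y : (tensor (I ⋙ Simp.shape P) L (Δ[1] : SSet.{u})).obj (op c')),
      IsCochain (I.obj c') k (ω.1 (op c') y).1 := fun c' y => (ω.1 (op c') y).2.1
  refine Eq.trans ?_ (delta_pullback (hI c i).getIso.inv (hω _ _).vanish).symm
  exact congrArg (pullback R _) (intersectionComplex_d_apply _ _ _ _)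

-- The section with no vertex of level 0 is the end 1 and the section with all vertices of level 0
-- is the end 0, so the homotopy formula exhibits the difference of the two restrictions as
-- null-homotopic.
variable (p I) in
include hI in
theorem isHomotopyInvariant_intersectionFunctor :
    IsHomotopyInvariant (I ⋙ Simp.shape P) (I.op ⋙ intersectionFunctor R p) := by
  intro L
  let h : ∀ i j, (ComplexShape.up ℕ).Rel j i →
      ((cochains (I.op ⋙ intersectionFunctor R p)
        (tensor (I ⋙ Simp.shape P) L (Δ[1] : SSet.{u}))).X i ⟶
      (cochains (I.op ⋙ intersectionFunctor R p) L).X j) := fun i j hij => by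
    obtain rfl : j + 1 = i := hij
    exact integrate L hI j
  have key : cochainsMap (I.op ⋙ intersectionFunctor R p)
      (tensorIncl (I ⋙ Simp.shape P) L 1) -
      cochainsMap (I.op ⋙ intersectionFunctor R p) (tensorIncl (I ⋙ Simp.shape P) L 0) =
      Homotopy.nullHomotopicMap' h := by
    have hd : ∀ (k : ℕ) (ω : naturalFamilies (I.op ⋙ intersectionFunctor R p)
        (tensor (I ⋙ Simp.shape P) L (Δ[1] : SSet.{u})) k) (c : C) (x : L.obj (op c)),
        (ω.1 (op c) (x, SSet.stdSimplex.const 1 1 _)).1 -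
          (ω.1 (op c) (x, SSet.stdSimplex.const 1 0 _)).1 =
        delta R (I.obj c) (prismInt R (I.obj c) (prismFamily p I hI ω c x)) +
          prismInt R (I.obj c) (fun i => delta R _ (prismFamily p I hI ω c x i)) :=
      fun k ω c x => by
        refine Eq.trans ?_ (delta_prismInt (fun i => (prismFamily_mem hI ω c x i).1.vanish)
          (fun a => (sectionFamily_mem ω c x a).1.vanish) (prismUpper_prismFamily hI ω c x)
          (prismLower_prismFamily hI ω c x)).symm
        exact congrArg₂ (fun χ₁ χ₂ => (ω.1 (op c) (x, χ₁)).1 - (ω.1 (op c) (x, χ₂)).1)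
          (stepSimplex_zero _).symm (stepSimplex_last _).symm
    have hd' : ∀ (k : ℕ) (ω : naturalFamilies (I.op ⋙ intersectionFunctor R p)
        (tensor (I ⋙ Simp.shape P) L (Δ[1] : SSet.{u})) k) (c : C) (x : L.obj (op c)),
        (show intersectionCochains R p (I.obj c) k from (integrate L hI k
          ((cochains (I.op ⋙ intersectionFunctor R p)
            (tensor (I ⋙ Simp.shape P) L (Δ[1] : SSet.{u}))).d k (k + 1) ω)).1 (op c) x).1 =
          prismInt R (I.obj c) (fun i => delta R _ (prismFamily p I hI ω c x i)) :=
      fun k ω c x => congrArg (prismInt R (I.obj c)) (funext (prismFamily_d hI ω c x))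
    refine HomologicalComplex.hom_ext _ _ fun k => ?_
    cases k with
    -- No degree lies below 0, so only `∫ δ ω` is available; the integral of a cochain of degree 0
    -- vanishes.
    | zero =>
      rw [Homotopy.nullHomotopicMap'_f_of_not_rel_right (k₀ := 1) rfl (by simp)]
      refine ModuleCat.hom_ext <| LinearMap.ext fun ω => Subtype.ext <| funext fun σ =>
        funext fun x => Subtype.ext ?_
      refine (hd 0 ω σ.unop x).trans ?_
      rw [prismInt_eq_zero fun i => (prismFamily_mem hI ω σ.unop x i).1, map_zero, zero_add]
      exact (hd' 0 ω σ.unop x).symm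
    | succ k =>
      rw [Homotopy.nullHomotopicMap'_f (k₂ := k) (k₀ := k + 2) rfl rfl]
      refine ModuleCat.hom_ext <| LinearMap.ext fun ω => Subtype.ext <| funext fun σ =>
        funext fun x => Subtype.ext ?_
      refine (hd (k + 1) ω σ.unop x).trans ((add_comm _ _).trans ?_)
      refine congrArg₂ (· + ·) (hd' (k + 1) ω σ.unop x).symm ?_
      exact (intersectionComplex_d_apply (p := p) (I.obj σ.unop) k
        ⟨prismInt R (I.obj σ.unop) (prismFamily p I hI ω σ.unop x), _⟩).symm
  -- Integration gives a homotopy from the end 1 to the end 0, whence the final reversal.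
  exact ⟨(Homotopy.equivSubZero.symm ((Homotopy.ofEq key).trans
    (Homotopy.nullHomotopy' h))).symm⟩

end Assembly

/-! ### Both categories of simplices are closed under doubling a vertex. -/

section Regular

variable {P : Type u} [PartialOrder P]

theorem isRegular_prism {σ : Simp P} (h : σ.IsRegular) (i : Fin (σ.dom.len + 1)) :
    (prism σ i).IsRegular := by
  have e : (prism σ i).top = σ.top := congrArg σ.chain Fin.predAbove_right_last
  rw [Simp.IsRegular, e]
  exact h

theorem essImage_id_prism (σ : Simp P) (i : Fin (((𝟭 (Simp P)).obj σ).dom.len + 1)) :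
    (𝟭 (Simp P)).essImage (prism ((𝟭 (Simp P)).obj σ) i) :=
  ⟨_, ⟨Iso.refl _⟩⟩

theorem essImage_incl_prism (σ : RegSimp P) (i : Fin (((RegSimp.incl P).obj σ).dom.len + 1)) :
    (RegSimp.incl P).essImage (prism ((RegSimp.incl P).obj σ) i) :=
  ⟨⟨prism σ.obj i, isRegular_prism σ.property i⟩, ⟨Iso.refl _⟩⟩

end Regular

end BlownUp

/-! ### The main theorem, for `Δ[P]` and `Δ[P]⁺`. -/

theorem mainTheorem3 {P : Type u} [PartialOrder P] {R : Type u} [CommRing R]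
    (p : BlownUp.Perversity P) :
    -- `⟨M⟩_p` is s-fibrant
    (∀ M : CochainComplex (ModuleCat.{u} R) ℕ,
      BlownUp.SFibrant (BlownUp.Simp.shape P) (BlownUp.bracket p M)) ∧
    -- the adjunction induces a bijection on homotopy classes
    (∀ L : BlownUp.SsetOver P, BlownUp.SFibrant (BlownUp.Simp.shape P) L →
      ∀ M : CochainComplex (ModuleCat.{u} R) ℕ,
      ∃ e : BlownUp.HtpyClasses (BlownUp.Simp.shape P) L (BlownUp.bracket p M) ≃
          BlownUp.CochainHtpyClasses M (BlownUp.blownUp R p L),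
        ∀ Φ : L ⟶ BlownUp.bracket p M,
          e (BlownUp.htpyClass (BlownUp.Simp.shape P) Φ) =
            BlownUp.cochainHtpyClass (BlownUp.adj (BlownUp.intersectionFunctor R p) L M Φ)) ∧
    -- blown up cohomology is represented by the perverse Eilenberg-MacLane simplicial sets
    (∀ n : ℕ, ∃ e : ∀ L : BlownUp.SsetOver P, BlownUp.SFibrant (BlownUp.Simp.shape P) L →
        (BlownUp.HtpyClasses (BlownUp.Simp.shape P) L (BlownUp.EML R p n) ≃
          (BlownUp.blownUp R p L).homology n),
      (∀ (L : BlownUp.SsetOver P) (hL : BlownUp.SFibrant (BlownUp.Simp.shape P) L)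
        (Φ : L ⟶ BlownUp.EML R p n),
        e L hL (BlownUp.htpyClass (BlownUp.Simp.shape P) Φ) =
          HomologicalComplex.homologyMap
            (BlownUp.adj (BlownUp.intersectionFunctor R p) L (BlownUp.singleComplex R n) Φ) n
            (BlownUp.generatorClass R n)) ∧
      ∀ (L L' : BlownUp.SsetOver P) (hL : BlownUp.SFibrant (BlownUp.Simp.shape P) L)
        (hL' : BlownUp.SFibrant (BlownUp.Simp.shape P) L') (f : L' ⟶ L)
        (x : BlownUp.HtpyClasses (BlownUp.Simp.shape P) L (BlownUp.EML R p n)),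
        e L' hL' (BlownUp.htpyPrecomp (BlownUp.Simp.shape P) f (BlownUp.EML R p n) x) =
          HomologicalComplex.homologyMap
            (BlownUp.cochainsMap (BlownUp.intersectionFunctor R p) f) n (e L hL x)) ∧
    -- the same for restricted simplicial sets over `P`
    (∀ n : ℕ, BlownUp.SFibrant (BlownUp.RegSimp.shape P) (BlownUp.EMLReg (P := P) R p n) ∧
      ∃ e : ∀ K : BlownUp.SsetOverReg P, BlownUp.SFibrant (BlownUp.RegSimp.shape P) K →
        (BlownUp.HtpyClasses (BlownUp.RegSimp.shape P) K (BlownUp.EMLReg R p n) ≃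
          (BlownUp.blownUpReg R p K).homology n),
      (∀ (K : BlownUp.SsetOverReg P) (hK : BlownUp.SFibrant (BlownUp.RegSimp.shape P) K)
        (Φ : K ⟶ BlownUp.EMLReg R p n),
        e K hK (BlownUp.htpyClass (BlownUp.RegSimp.shape P) Φ) =
          HomologicalComplex.homologyMap
            (BlownUp.adj (BlownUp.intersectionFunctorReg R p) K (BlownUp.singleComplex R n) Φ) n
            (BlownUp.generatorClass R n)) ∧
      ∀ (K K' : BlownUp.SsetOverReg P) (hK : BlownUp.SFibrant (BlownUp.RegSimp.shape P) K)
        (hK' : BlownUp.SFibrant (BlownUp.RegSimp.shape P) K') (f : K' ⟶ K)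
        (x : BlownUp.HtpyClasses (BlownUp.RegSimp.shape P) K (BlownUp.EMLReg R p n)),
        e K' hK' (BlownUp.htpyPrecomp (BlownUp.RegSimp.shape P) f (BlownUp.EMLReg R p n) x) =
          HomologicalComplex.homologyMap
            (BlownUp.cochainsMap (BlownUp.intersectionFunctorReg R p) f) n (e K hK x)) := by
  -- The unrestricted case takes the identity functor for `I`; the composites with it agree with the
  -- original functors by definition.
  have h := BlownUp.isHomotopyInvariant_intersectionFunctor (R := R) p (𝟭 (BlownUp.Simp P))
    BlownUp.essImage_id_prism
  have h' := BlownUp.isExtendable_intersectionFunctor (R := R) p (𝟭 (BlownUp.Simp P))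
  have hr := BlownUp.isHomotopyInvariant_intersectionFunctor (R := R) p (BlownUp.RegSimp.incl P)
    BlownUp.essImage_incl_prism
  have hr' := BlownUp.isExtendable_intersectionFunctor (R := R) p (BlownUp.RegSimp.incl P)
  refine ⟨fun M => BlownUp.sFibrant_realize _ _ M,
    fun L _ M => BlownUp.exists_htpyClasses_equiv h h' L M, fun n => ?_,
    fun n => ⟨BlownUp.sFibrant_realize _ _ _, ?_⟩⟩
  · obtain ⟨e, he, hnat⟩ := BlownUp.exists_htpyClasses_equiv_homology h h' n
    exact ⟨fun L _ => e L, fun L _ Φ => he L Φ, fun L L' _ _ f x => hnat L L' f x⟩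
  · obtain ⟨e, he, hnat⟩ := BlownUp.exists_htpyClasses_equiv_homology hr hr' n
    exact ⟨fun L _ => e L, fun L _ Φ => he L Φ, fun L L' _ _ f x => hnat L L' f x⟩
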